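/- Let $\Omega\subset\mathbb R^d$, $d\ge 1$, be a bounded open set (for instance a bounded Lipschitz domain). For $\mathbb K\in\{\mathbb R,\mathbb C\}$ let $H^1_0(\Omega;\mathbb K)$ be the closure of $C_c^\infty(\Omega;\mathbb K)$ in $H^1(\Omega;\mathbb K)$, with the inner product $(u,v)_{H^1_0}=(\nabla u,\nabla v)_{L^2(\Omega)}$. Let $\mathbb V_h\subset H^1_0(\Omega;\mathbb R)$ be a finite-dimensional real subspace, and for a real subspace $V\subset\mathbb V_h$ let $V^{\mathbb C}=\{v+\imath w: v,w\in V\}\subset H^1_0(\Omega;\mathbb C)$ be its complexification. Let $\alpha\in\mathbb R$, $R\in\mathbb N_0$, and let $u_h:(0,\infty)\to\mathbb V_h$ be measurable with $\int_0^\infty\|u_h(t)\|^2_{H^1_0}e^{-2\alpha t}\,dt<\infty$. Let $\widehat u_h(s)=\int_0^\infty e^{-st}u_h(t)\,dt\in\mathbb V_h^{\mathbb C}$ for $\Re s>\alpha$ be its Laplace transform. For a complex Hilbert space $X$, $\mathscr H^2_\alpha(X)$ is the space of holomorphic $F:\{\Re s>\alpha\}\to X$ such that $$\|F\|_{\mathscr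 H^2_\alpha}=\sup_{\sigma>\alpha}\Big(\int_{-\infty}^\infty\|F(\sigma+\imath\tau)\|^2\,\tfrac{d\tau}{2\pi}\Big)^{1/2}<\infty$$ and such that the boundary value $F(\alpha+\imath\tau)=\lim_{\sigma\to\alpha^+}F(\sigma+\imath\tau)$ exists for a.e. $\tau\in\mathbb R$ and is square integrable in $\tau$. Write $\mathsf P_X$ for the $H^1_0$-orthogonal projection onto $X$, and consider the two minimization problems $$\text{(C)}\quad \min_{X\subset\mathbb V_h^{\mathbb C},\ \dim_{\mathbb C}X\le R}\ \|\widehat u_h-\mathsf P_X\widehat u_h\|^2_{\mathscr H^2_\alpha(H^1_0(\Omega;\mathbb C))},$$ $$\text{(R)}\quad \min_{V\subset\mathbb V_h,\ \dim_{\mathbb R}V\le R}\ \int_{-\infty}^\infty\big\|\Re\{\widehat u_h(\alpha+\imath\tau)\}-\mathsf P_V\Re\{\widehat u_h(\alpha+\imath\tau)\}\big\|^2_{H^1_0}\,d\tau,$$ over complex subspaces $X$ of $\mathbb V_h^{\mathbb C}$ and real subspaces $V$ of $\mathbb V_h$, respectively. Then $\widehat u_h\in\mathscr H^2_\alpha(\mathbb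 V_h^{\mathbb C})$, both problems have a minimizer, and: 1. A real subspace $V\subset\mathbb V_h$ is a minimizer of (R) if and only if $V^{\mathbb C}$ is a minimizer of (C). 2. A complex subspace $W\subset\mathbb V_h^{\mathbb C}$ is the unique minimizer of (C) if and only if $W=V^{\mathbb C}$ for a real subspace $V\subset\mathbb V_h$ that is the unique minimizer of (R). In particular, whenever the optimal reduced space $\mathbb V^{(\mathrm{rb})}_R=\operatorname{argmin}$ of (C) is well defined (unique), it coincides with the unique minimizer of (R), and it is real: it is spanned by elements of $\mathbb V_h$. -/

import Mathlib

open MeasureTheory Filter Topology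
open scoped ENNReal ContDiff

noncomputable section

/-- A bounded open subset of `ℝ^d`. -/
structure BoundedOpen (d : ℕ) where
  carrier : Set (EuclideanSpace ℝ (Fin d))
  isOpen : IsOpen carrier
  isBounded : Bornology.IsBounded carrier

namespace BoundedOpen

variable {d : ℕ}

/-- Lebesgue measure on `Ω`. -/
def measure (Ω : BoundedOpen d) : Measure (EuclideanSpace ℝ (Fin d)) :=
  volume.restrict Ω.carrier

end BoundedOpen

/-! ### The Sobolev space `H¹₀(Ω; 𝕂)` with the inner product `(∇u, ∇v)` -/

section Sobolev

variable {d : ℕ}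

/-- `φ ∈ C_c^∞(Ω; 𝕂)`. -/
def IsTestFunction (Ω : BoundedOpen d) (𝕂 : Type) [RCLike 𝕂]
    (φ : EuclideanSpace ℝ (Fin d) → 𝕂) : Prop :=
  ContDiff ℝ ∞ φ ∧ HasCompactSupport φ ∧ tsupport φ ⊆ Ω.carrier

/-- The classical partial derivative `∂ᵢ φ`. -/
def partialDeriv {𝕂 : Type} [RCLike 𝕂] (i : Fin d) (φ : EuclideanSpace ℝ (Fin d) → 𝕂)
    (x : EuclideanSpace ℝ (Fin d)) : 𝕂 :=
  fderiv ℝ φ x (EuclideanSpace.single i 1)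

/-- `L²(Ω; 𝕂) × L²(Ω; 𝕂)^d`, the space in which the pairs `(u, ∇u)`, `u ∈ H¹(Ω; 𝕂)`, live. Its
product topology induces the `H¹` topology on these pairs. -/
abbrev SobolevAmbient (Ω : BoundedOpen d) (𝕂 : Type) [RCLike 𝕂] : Type :=
  Lp 𝕂 2 Ω.measure × PiLp 2 (fun _ : Fin d => Lp 𝕂 2 Ω.measure)

/-- The pairs `(φ, ∇φ)` with `φ ∈ C_c^∞(Ω; 𝕂)`. -/
def testPairs (Ω : BoundedOpen d) (𝕂 : Type) [RCLike 𝕂] :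
    Submodule 𝕂 (SobolevAmbient Ω 𝕂) where
  carrier := {p | ∃ φ, IsTestFunction Ω 𝕂 φ ∧ p.1 =ᵐ[Ω.measure] φ ∧
    ∀ i, p.2 i =ᵐ[Ω.measure] partialDeriv i φ}
  zero_mem' := by
    refine ⟨0, ⟨contDiff_const, HasCompactSupport.zero, by simp⟩, Lp.coeFn_zero _ _ _, fun i => ?_⟩
    have h : partialDeriv i (0 : EuclideanSpace ℝ (Fin d) → 𝕂) = 0 := by
      funext x; simp [partialDeriv]
    rw [h]
    exact Lp.coeFn_zero _ _ _
  add_mem' := by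
    rintro p q ⟨φ, ⟨h1, h2, h3⟩, h4, h5⟩ ⟨ψ, ⟨k1, k2, k3⟩, k4, k5⟩
    refine ⟨φ + ψ, ⟨h1.add k1, h2.add k2, ?_⟩, ?_, fun i => ?_⟩
    · exact (tsupport_add φ ψ).trans (Set.union_subset h3 k3)
    · exact (Lp.coeFn_add _ _).trans (h4.add k4)
    · have h : partialDeriv i (φ + ψ) = partialDeriv i φ + partialDeriv i ψ := by
        funext x
        simp only [partialDeriv, Pi.add_apply]
        rw [fderiv_add ((h1.differentiable (by simp)) x) ((k1.differentiable (by simp)) x)]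
        rfl
      rw [h]
      exact (Lp.coeFn_add _ _).trans ((h5 i).add (k5 i))
  smul_mem' := by
    rintro c p ⟨φ, ⟨h1, h2, h3⟩, h4, h5⟩
    refine ⟨c • φ, ⟨h1.const_smul c, h2.smul_left, ?_⟩, ?_, fun i => ?_⟩
    · exact (closure_mono (Function.support_const_smul_subset c φ)).trans h3
    · exact (Lp.coeFn_smul _ _).trans (h4.const_smul c)
    · have h : partialDeriv i (c • φ) = c • partialDeriv i φ := by
        funext x
        simp only [partialDeriv, Pi.smul_apply]
        rw [fderiv_const_smul ((h1.differentiable (by simp)) x) c]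
        rfl
      rw [h]
      exact (Lp.coeFn_smul _ _).trans ((h5 i).const_smul c)

/-- `H¹₀(Ω; 𝕂)`: the closure of `C_c^∞(Ω; 𝕂)` in `H¹(Ω; 𝕂)`. An element is stored as the pair
`(u, ∇u)` of the function and its weak gradient. -/
def H10 (Ω : BoundedOpen d) (𝕂 : Type) [RCLike 𝕂] : Type :=
  ↥(testPairs Ω 𝕂).topologicalClosure

namespace H10

variable {Ω : BoundedOpen d} {𝕂 : Type} [RCLike 𝕂]

instance : AddCommGroup (H10 Ω 𝕂) :=
  inferInstanceAs (AddCommGroup ↥(testPairs Ω 𝕂).topologicalClosure)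

instance : Module 𝕂 (H10 Ω 𝕂) :=
  inferInstanceAs (Module 𝕂 ↥(testPairs Ω 𝕂).topologicalClosure)

/-- The pair `(u, ∇u)`. -/
def pair : H10 Ω 𝕂 →ₗ[𝕂] SobolevAmbient Ω 𝕂 := (testPairs Ω 𝕂).topologicalClosure.subtype

/-- The function `u ∈ L²(Ω; 𝕂)` itself. -/
def toL2 (u : H10 Ω 𝕂) : Lp 𝕂 2 Ω.measure := (pair u).1

/-- The weak gradient `∇u`, a vector of `d` functions in `L²(Ω; 𝕂)`. -/
def grad (u : H10 Ω 𝕂) : PiLp 2 (fun _ : Fin d => Lp 𝕂 2 Ω.measure) := (pair u).2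

theorem pair_injective : Function.Injective (pair : H10 Ω 𝕂 →ₗ[𝕂] SobolevAmbient Ω 𝕂) :=
  Subtype.val_injective

theorem pair_mem (u : H10 Ω 𝕂) : pair u ∈ (testPairs Ω 𝕂).topologicalClosure := u.2

/-- An element of `H¹₀(Ω; 𝕂)` from its pair `(u, ∇u)`. -/
def ofPair (p : SobolevAmbient Ω 𝕂) (hp : p ∈ (testPairs Ω 𝕂).topologicalClosure) : H10 Ω 𝕂 :=
  ⟨p, hp⟩

theorem pair_ofPair (p : SobolevAmbient Ω 𝕂) (hp : p ∈ (testPairs Ω 𝕂).topologicalClosure) :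
    pair (ofPair p hp) = p := rfl

theorem grad_add (u v : H10 Ω 𝕂) : (u + v).grad = u.grad + v.grad := by
  simp [grad]

theorem grad_smul (c : 𝕂) (u : H10 Ω 𝕂) : (c • u).grad = c • u.grad := by
  simp [grad]

end H10

/-- Poincaré's inequality for test functions. -/
theorem poincare_testFunction [NeZero d] (Ω : BoundedOpen d) (𝕂 : Type) [RCLike 𝕂] :
    ∃ C : ℝ, 0 ≤ C ∧ ∀ φ, IsTestFunction Ω 𝕂 φ →
      ∫ x, ‖φ x‖ ^ 2 ≤ C * ∫ x, ‖partialDeriv 0 φ x‖ ^ 2 := by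
  obtain ⟨R, hR⟩ := Ω.isBounded.subset_closedBall 0
  refine ⟨4 * R ^ 2, by positivity, ?_⟩
  rintro φ ⟨h1, h2, h3⟩
  have hd : Differentiable ℝ φ := h1.differentiable (by simp)
  set e : EuclideanSpace ℝ (Fin d) := EuclideanSpace.single 0 1 with he
  have hDc : Continuous (partialDeriv 0 φ) :=
    (h1.continuous_fderiv (by simp)).clm_apply continuous_const
  have hDs : HasCompactSupport (partialDeriv 0 φ) := by
    have := h2.fderiv (𝕜 := ℝ)
    exact this.comp_left (g := fun L : EuclideanSpace ℝ (Fin d) →L[ℝ] 𝕂 => L e) (by simp)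
  have hderiv : ∀ x, fderiv ℝ (fun y => ‖φ y‖ ^ 2) x e
      = 2 * inner ℝ (φ x) (partialDeriv 0 φ x) := by
    intro x
    have := ((hd x).hasFDerivAt.norm_sq).fderiv
    rw [this]
    simp [partialDeriv, he]
  have hcs : ∀ f : EuclideanSpace ℝ (Fin d) → ℝ, Continuous f → (∀ x, φ x = 0 → f x = 0) →
      Integrable f := by
    intro f hf h0
    refine hf.integrable_of_hasCompactSupport (h2.mono ?_)
    intro x hx hx'
    exact hx (h0 x hx')
  have hx0 : ∀ x, HasFDerivAt (fun y : EuclideanSpace ℝ (Fin d) => y 0)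
      (EuclideanSpace.proj (𝕜 := ℝ) (0 : Fin d) : EuclideanSpace ℝ (Fin d) →L[ℝ] ℝ) x := fun x =>
    (EuclideanSpace.proj (𝕜 := ℝ) (0 : Fin d) :
      EuclideanSpace ℝ (Fin d) →L[ℝ] ℝ).hasFDerivAt
  have hcoord : Continuous (fun y : EuclideanSpace ℝ (Fin d) => y 0) := by fun_prop
  have hφc := h1.continuous
  have key := integral_mul_fderiv_eq_neg_fderiv_mul_of_integrable
    (μ := (volume : Measure (EuclideanSpace ℝ (Fin d))))
    (f := fun y : EuclideanSpace ℝ (Fin d) => y 0) (g := fun y => ‖φ y‖ ^ 2) (v := e)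
    (by
      refine hcs _ ?_ (fun x hx => by simp [hx])
      simp only [(hx0 _).fderiv]
      fun_prop)
    (by
      simp only [hderiv]
      refine hcs _ ?_ (fun x hx => by simp [hx])
      fun_prop)
    (hcs _ (by fun_prop) (fun x hx => by simp [hx]))
    (fun x _ => (hx0 x).differentiableAt)
    (fun x _ => ((hd x).hasFDerivAt.norm_sq).differentiableAt)
  simp only [hderiv, (hx0 _).fderiv] at key
  have he0 : (EuclideanSpace.proj (𝕜 := ℝ) (0 : Fin d) : EuclideanSpace ℝ (Fin d) →L[ℝ] ℝ) e
      = 1 := by simp [he]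
  simp only [he0, one_mul] at key
  have hI1 : Integrable (fun x => ‖φ x‖ ^ 2) := hcs _ (by fun_prop) (fun x hx => by simp [hx])
  have hI2 : Integrable (fun x => ‖partialDeriv 0 φ x‖ ^ 2) := by
    refine Continuous.integrable_of_hasCompactSupport (by fun_prop) (hDs.mono ?_)
    intro x hx hx'
    exact hx (by simp [hx'])
  have hI3 : Integrable (fun x : EuclideanSpace ℝ (Fin d) =>
      x 0 * (2 * inner ℝ (φ x) (partialDeriv 0 φ x))) :=
    hcs _ (by fun_prop) (fun x hx => by simp [hx])
  have hpt : ∀ x : EuclideanSpace ℝ (Fin d),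
      -(x 0 * (2 * inner ℝ (φ x) (partialDeriv 0 φ x)))
        ≤ 2⁻¹ * ‖φ x‖ ^ 2 + 2 * R ^ 2 * ‖partialDeriv 0 φ x‖ ^ 2 := by
    intro x
    by_cases hx : φ x = 0
    · simp only [hx, inner_zero_left, mul_zero, neg_zero, norm_zero]
      positivity
    · have hxΩ : x ∈ Ω.carrier := h3 (subset_tsupport _ hx)
      have hxR : ‖x‖ ≤ R := by simpa using hR hxΩ
      have hx0R : |x 0| ≤ R := (PiLp.norm_apply_le x 0).trans hxR
      have hin := abs_real_inner_le_norm (φ x) (partialDeriv 0 φ x)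
      have h5 : |x 0 * inner ℝ (φ x) (partialDeriv 0 φ x)|
          ≤ R * (‖φ x‖ * ‖partialDeriv 0 φ x‖) := by
        rw [abs_mul]
        exact mul_le_mul hx0R hin (abs_nonneg _) ((abs_nonneg _).trans hx0R)
      have h6 := neg_abs_le (x 0 * inner ℝ (φ x) (partialDeriv 0 φ x))
      nlinarith [sq_nonneg (‖φ x‖ - 2 * R * ‖partialDeriv 0 φ x‖)]
  have hint : ∫ x, ‖φ x‖ ^ 2 ≤ (2⁻¹ * ∫ x, ‖φ x‖ ^ 2)
      + (2 * R ^ 2 * ∫ x, ‖partialDeriv 0 φ x‖ ^ 2) := by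
    have h7 : ∫ x, ‖φ x‖ ^ 2 = ∫ x : EuclideanSpace ℝ (Fin d),
        -(x 0 * (2 * inner ℝ (φ x) (partialDeriv 0 φ x))) := by
      rw [integral_neg, key, neg_neg]
    rw [← integral_const_mul, ← integral_const_mul,
      ← integral_add (hI1.const_mul _) (hI2.const_mul _)]
    rw [h7]
    exact integral_mono hI3.neg ((hI1.const_mul _).add (hI2.const_mul _)) hpt
  linarith

theorem Lp_two_norm_sq {Ω : BoundedOpen d} {𝕂 : Type} [RCLike 𝕂] (f : Lp 𝕂 2 Ω.measure) :
    ‖f‖ ^ 2 = ∫ x, ‖f x‖ ^ 2 ∂Ω.measure := by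
  rw [← inner_self_eq_norm_sq (𝕜 := 𝕂), L2.inner_def, ← integral_re (L2.integrable_inner f f)]
  simp only [inner_self_eq_norm_sq]

/-- Poincaré's inequality on the closure. -/
theorem poincare_H10 [NeZero d] (Ω : BoundedOpen d) (𝕂 : Type) [RCLike 𝕂] :
    ∃ C : ℝ, 0 ≤ C ∧ ∀ u : H10 Ω 𝕂, ‖u.toL2‖ ^ 2 ≤ C * ‖u.grad‖ ^ 2 := by
  obtain ⟨C, hC, h⟩ := poincare_testFunction Ω 𝕂
  refine ⟨C, hC, fun u => ?_⟩
  have hcl : IsClosed {p : SobolevAmbient Ω 𝕂 | ‖p.1‖ ^ 2 ≤ C * ‖p.2‖ ^ 2} :=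
    isClosed_le (by fun_prop) (by fun_prop)
  have hsub : (testPairs Ω 𝕂 : Set (SobolevAmbient Ω 𝕂)) ⊆
      {p : SobolevAmbient Ω 𝕂 | ‖p.1‖ ^ 2 ≤ C * ‖p.2‖ ^ 2} := by
    rintro p ⟨φ, hφ, h4, h5⟩
    have hsupp : ∀ x, x ∉ Ω.carrier → φ x = 0 ∧ partialDeriv 0 φ x = 0 := by
      intro x hx
      have hx' : x ∉ tsupport φ := fun h => hx (hφ.2.2 h)
      refine ⟨image_eq_zero_of_notMem_tsupport hx', ?_⟩
      have : fderiv ℝ φ x = 0 := by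
        by_contra hne
        exact hx' (support_fderiv_subset ℝ hne)
      simp [partialDeriv, this]
    have e1 : ‖p.1‖ ^ 2 = ∫ x, ‖φ x‖ ^ 2 := by
      rw [Lp_two_norm_sq, integral_congr_ae (g := fun x => ‖φ x‖ ^ 2)
        (h4.mono fun x hx => by simp only [hx])]
      exact setIntegral_eq_integral_of_forall_compl_eq_zero fun x hx => by simp [(hsupp x hx).1]
    have e2 : ‖p.2 0‖ ^ 2 = ∫ x, ‖partialDeriv 0 φ x‖ ^ 2 := by
      rw [Lp_two_norm_sq, integral_congr_ae (g := fun x => ‖partialDeriv 0 φ x‖ ^ 2)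
        ((h5 0).mono fun x hx => by simp only [hx])]
      exact setIntegral_eq_integral_of_forall_compl_eq_zero fun x hx => by simp [(hsupp x hx).2]
    have e3 : ‖p.2 0‖ ≤ ‖p.2‖ := PiLp.norm_apply_le p.2 0
    calc ‖p.1‖ ^ 2 ≤ C * ‖p.2 0‖ ^ 2 := by rw [e1, e2]; exact h φ hφ
      _ ≤ C * ‖p.2‖ ^ 2 := by gcongr
  exact closure_minimal hsub hcl u.pair_mem

namespace H10

variable [NeZero d] {Ω : BoundedOpen d} {𝕂 : Type} [RCLike 𝕂]

/-- The inner product `(u, v)_{H¹₀} = (∇u, ∇v)_{L²}` (conjugate linear in the first slot). -/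
instance core : InnerProductSpace.Core 𝕂 (H10 Ω 𝕂) where
  inner u v := inner 𝕂 u.grad v.grad
  conj_inner_symm u v := inner_conj_symm _ _
  re_inner_nonneg u := inner_self_nonneg
  add_left u v w := by rw [grad_add, inner_add_left]
  smul_left u v c := by rw [grad_smul, inner_smul_left]
  definite u hu := by
    obtain ⟨C, _, h⟩ := poincare_H10 Ω 𝕂
    have hg : u.grad = 0 := inner_self_eq_zero.mp hu
    have hf : u.toL2 = 0 := by
      have := h u
      rw [hg, norm_zero] at this
      have h0 : ‖u.toL2‖ ^ 2 ≤ 0 := by simpa using this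
      exact norm_eq_zero.mp (pow_eq_zero_iff two_ne_zero |>.mp (le_antisymm h0 (sq_nonneg _)))
    exact pair_injective (by rw [map_zero]; exact Prod.ext hf hg)

instance : NormedAddCommGroup (H10 Ω 𝕂) := InnerProductSpace.Core.toNormedAddCommGroup (𝕜 := 𝕂)

instance : InnerProductSpace 𝕂 (H10 Ω 𝕂) := InnerProductSpace.ofCore _

theorem inner_eq (u v : H10 Ω 𝕂) : inner 𝕂 u v = inner 𝕂 u.grad v.grad := rfl

end H10

/-! ### Real and complex valued functions -/

namespace H10

variable {Ω : BoundedOpen d}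

/-- Pointwise application of an `ℝ`-linear map of scalars to `(u, ∇u)`. -/
def mapAmbient (Ω : BoundedOpen d) {𝕂 𝕃 : Type} [RCLike 𝕂] [RCLike 𝕃] (L : 𝕂 →L[ℝ] 𝕃)
    (p : SobolevAmbient Ω 𝕂) : SobolevAmbient Ω 𝕃 :=
  (L.compLp p.1, WithLp.toLp 2 fun i => L.compLp (p.2 i))

theorem continuous_mapAmbient {𝕂 𝕃 : Type} [RCLike 𝕂] [RCLike 𝕃] (L : 𝕂 →L[ℝ] 𝕃) :
    Continuous (mapAmbient Ω L) := by
  have hL : Continuous fun f : Lp 𝕂 2 Ω.measure => L.compLp f :=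
    (L.compLpL 2 Ω.measure).continuous
  refine Continuous.prodMk (hL.comp continuous_fst) ?_
  refine (PiLp.continuous_toLp 2 _).comp (continuous_pi fun i => hL.comp ?_)
  exact (PiLp.continuous_apply 2 _ i).comp continuous_snd

theorem mapAmbient_mem {𝕂 𝕃 : Type} [RCLike 𝕂] [RCLike 𝕃] (L : 𝕂 →L[ℝ] 𝕃)
    {p : SobolevAmbient Ω 𝕂} (hp : p ∈ (testPairs Ω 𝕂).topologicalClosure) :
    mapAmbient Ω L p ∈ (testPairs Ω 𝕃).topologicalClosure := by
  refine map_mem_closure (continuous_mapAmbient L) hp ?_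
  rintro p ⟨φ, ⟨h1, h2, h3⟩, h4, h5⟩
  refine ⟨L ∘ φ, ⟨L.contDiff.comp h1, h2.comp_left (map_zero L), ?_⟩, ?_, fun i => ?_⟩
  · exact (closure_mono (Function.support_comp_subset (map_zero L) φ)).trans h3
  · filter_upwards [L.coeFn_compLp p.1, h4] with x hx hx'
    simp only [mapAmbient, hx, hx', Function.comp]
  · filter_upwards [L.coeFn_compLp (p.2 i), h5 i] with x hx hx'
    have hd : DifferentiableAt ℝ φ x := (h1.differentiable (by simp)) x
    have : partialDeriv i (L ∘ φ) x = L (partialDeriv i φ x) := by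
      simp only [partialDeriv]
      rw [fderiv_comp x L.differentiableAt hd, L.fderiv]
      rfl
    rw [this]
    simp only [mapAmbient, hx, hx']

theorem mapAmbient_add {𝕂 𝕃 : Type} [RCLike 𝕂] [RCLike 𝕃] (L : 𝕂 →L[ℝ] 𝕃)
    (p q : SobolevAmbient Ω 𝕂) :
    mapAmbient Ω L (p + q) = mapAmbient Ω L p + mapAmbient Ω L q := by
  have h : ∀ f g : Lp 𝕂 2 Ω.measure, L.compLp (f + g) = L.compLp f + L.compLp g := fun f g =>
    map_add (L.compLpₗ 2 Ω.measure) f g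
  refine Prod.ext (h _ _) ?_
  refine PiLp.ext fun i => ?_
  exact h _ _

theorem mapAmbient_smul {𝕂 𝕃 : Type} [RCLike 𝕂] [RCLike 𝕃] (L : 𝕂 →L[ℝ] 𝕃) (c : ℝ)
    (p : SobolevAmbient Ω 𝕂) :
    mapAmbient Ω L ((c : 𝕂) • p) = (c : 𝕃) • mapAmbient Ω L p := by
  have h : ∀ f : Lp 𝕂 2 Ω.measure, L.compLp ((c : 𝕂) • f) = (c : 𝕃) • L.compLp f := by
    intro f
    ext1
    filter_upwards [L.coeFn_compLp ((c : 𝕂) • f), L.coeFn_compLp f, Lp.coeFn_smul (c : 𝕂) f,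
      Lp.coeFn_smul (c : 𝕃) (L.compLp f)] with x h1 h2 h3 h4
    rw [h1, h3, h4, Pi.smul_apply, Pi.smul_apply, h2, ← RCLike.real_smul_eq_coe_smul,
      ← RCLike.real_smul_eq_coe_smul, map_smul]
  refine Prod.ext (h _) ?_
  refine PiLp.ext fun i => ?_
  exact h _

variable [NeZero d]

/-- A real valued function regarded as a complex valued one. -/
def ofReal : H10 Ω ℝ →ₗ[ℝ] H10 Ω ℂ where
  toFun u := ofPair (mapAmbient Ω Complex.ofRealCLM u.pair) (mapAmbient_mem _ u.pair_mem)
  map_add' u v := pair_injective <| by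
    simp only [map_add, pair_ofPair, mapAmbient_add]
  map_smul' c u := pair_injective <| by
    have h := mapAmbient_smul Complex.ofRealCLM c u.pair
    have h' : ∀ x : H10 Ω ℂ, pair (c • x) = (c : ℂ) • pair x := fun x => map_smul pair (c : ℂ) x
    simp only [map_smul, pair_ofPair, RingHom.id_apply, h']
    exact h

/-- The pointwise real part of a complex valued function. -/
def re : H10 Ω ℂ →ₗ[ℝ] H10 Ω ℝ where
  toFun u := ofPair (mapAmbient Ω Complex.reCLM u.pair) (mapAmbient_mem _ u.pair_mem)
  map_add' u v := pair_injective <| by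
    simp only [map_add, pair_ofPair, mapAmbient_add]
  map_smul' c u := pair_injective <| by
    have h := mapAmbient_smul Complex.reCLM c u.pair
    have h' : ∀ x : H10 Ω ℂ, pair (c • x) = (c : ℂ) • pair x := fun x => map_smul pair (c : ℂ) x
    simp only [map_smul, pair_ofPair, RingHom.id_apply, h']
    exact h

/-- `re` is the left inverse of `ofReal`. -/
theorem re_ofReal (u : H10 Ω ℝ) : re (ofReal u) = u := by
  have h : ∀ f : Lp ℝ 2 Ω.measure, Complex.reCLM.compLp (Complex.ofRealCLM.compLp f) = f := by
    intro f
    ext1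
    filter_upwards [Complex.reCLM.coeFn_compLp (Complex.ofRealCLM.compLp f),
      Complex.ofRealCLM.coeFn_compLp f] with x h1 h2
    rw [h1, h2]
    simp
  refine pair_injective (Prod.ext (h _) ?_)
  refine PiLp.ext fun i => ?_
  exact h _

theorem re_I_smul_ofReal (u : H10 Ω ℝ) : re (Complex.I • ofReal u) = 0 := by
  have h : ∀ f : Lp ℝ 2 Ω.measure,
      Complex.reCLM.compLp (Complex.I • Complex.ofRealCLM.compLp f) = 0 := by
    intro f
    ext1
    filter_upwards [Complex.reCLM.coeFn_compLp (Complex.I • Complex.ofRealCLM.compLp f),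
      Complex.ofRealCLM.coeFn_compLp f, Lp.coeFn_smul Complex.I (Complex.ofRealCLM.compLp f),
      Lp.coeFn_zero ℝ 2 Ω.measure] with x h1 h2 h3 h4
    rw [h1, h3, h4, Pi.smul_apply, h2]
    simp
  refine pair_injective (Prod.ext (h _) ?_)
  refine PiLp.ext fun i => ?_
  exact h _

end H10

end Sobolev

/-! ### The space `V_h` and its complexification -/

section Complexification

variable {d : ℕ} [NeZero d] {Ω : BoundedOpen d}

/-- The complexification `V_h^ℂ = {v + i w : v, w ∈ V_h}` of a real space `V_h ⊆ H¹₀(Ω; ℝ)`, as a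
complex subspace of `H¹₀(Ω; ℂ)`. -/
def complexification (Vh : Submodule ℝ (H10 Ω ℝ)) : Submodule ℂ (H10 Ω ℂ) where
  carrier := {x | ∃ v ∈ Vh, ∃ w ∈ Vh, x = H10.ofReal v + Complex.I • H10.ofReal w}
  zero_mem' := ⟨0, Vh.zero_mem, 0, Vh.zero_mem, by simp⟩
  add_mem' := by
    rintro _ _ ⟨v, hv, w, hw, rfl⟩ ⟨v', hv', w', hw', rfl⟩
    refine ⟨v + v', Vh.add_mem hv hv', w + w', Vh.add_mem hw hw', ?_⟩
    simp only [map_add, smul_add]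
    abel
  smul_mem' := by
    rintro c _ ⟨v, hv, w, hw, rfl⟩
    refine ⟨c.re • v - c.im • w, Vh.sub_mem (Vh.smul_mem _ hv) (Vh.smul_mem _ hw),
      c.im • v + c.re • w, Vh.add_mem (Vh.smul_mem _ hv) (Vh.smul_mem _ hw), ?_⟩
    have h : ∀ (r : ℝ) (x : H10 Ω ℂ), r • x = (r : ℂ) • x := fun r x => rfl
    simp only [map_add, map_sub, map_smul, h]
    generalize H10.ofReal v = x
    generalize H10.ofReal w = y
    have hI : Complex.I * (c.im : ℂ) + c.re = c := by
      rw [mul_comm, add_comm]; exact Complex.re_add_im c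
    have hI' : (-c.im : ℂ) + Complex.I * c.re = c * Complex.I := by
      nth_rewrite 3 [← hI]
      linear_combination (-(c.im : ℂ)) * Complex.I_mul_I
    have e : c • (x + Complex.I • y)
        = (Complex.I * (c.im : ℂ) + c.re) • x + ((-c.im : ℂ) + Complex.I * c.re) • y := by
      rw [hI, hI', smul_add, smul_smul]
    rw [e]
    module

variable (Vh : Submodule ℝ (H10 Ω ℝ))

/-- The inclusion `V_h → V_h^ℂ`. -/
def toComplex : Vh →ₗ[ℝ] complexification Vh where
  toFun v := ⟨H10.ofReal v, v, v.2, 0, Vh.zero_mem, by simp⟩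
  map_add' v w := Subtype.ext (by simp)
  map_smul' c v := Subtype.ext (by simp)

/-- The real part `V_h^ℂ → V_h`, `v + i w ↦ v`. -/
def complexToReal : complexification Vh →ₗ[ℝ] Vh where
  toFun x := ⟨H10.re (x : H10 Ω ℂ), by
    obtain ⟨v, hv, w, hw, h⟩ := x.2
    rw [h, map_add, H10.re_ofReal, H10.re_I_smul_ofReal, add_zero]
    exact hv⟩
  map_add' v w := Subtype.ext (by simp)
  map_smul' c v := Subtype.ext (by simp)

instance [FiniteDimensional ℝ Vh] : FiniteDimensional ℂ (complexification Vh) := by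
  obtain ⟨s, hs⟩ := (Submodule.fg_iff_finiteDimensional Vh).mpr inferInstance
  have hmem : ∀ v ∈ Vh, H10.ofReal v ∈ Submodule.span ℂ (H10.ofReal '' (s : Set (H10 Ω ℝ))) := by
    intro v hv
    rw [← hs] at hv
    induction hv using Submodule.span_induction with
    | mem x hx => exact Submodule.subset_span ⟨x, hx, rfl⟩
    | zero => simp
    | add x y _ _ hx hy => rw [map_add]; exact Submodule.add_mem _ hx hy
    | smul c x _ hx => rw [map_smul]; exact Submodule.smul_mem _ (c : ℂ) hx
  have hle : complexification Vh ≤ Submodule.span ℂ (H10.ofReal '' (s : Set (H10 Ω ℝ))) := by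
    rintro _ ⟨v, hv, w, hw, rfl⟩
    exact Submodule.add_mem _ (hmem v hv) (Submodule.smul_mem _ _ (hmem w hw))
  have : FiniteDimensional ℂ (Submodule.span ℂ (H10.ofReal '' (s : Set (H10 Ω ℝ)))) :=
    FiniteDimensional.span_of_finite ℂ (s.finite_toSet.image _)
  exact Submodule.finiteDimensional_of_le hle

/-- The complexification `V^ℂ` of a real subspace `V ⊆ V_h`, as a complex subspace of `V_h^ℂ`. -/
def complexify (V : Submodule ℝ Vh) : Submodule ℂ (complexification Vh) :=
  (complexification (V.map Vh.subtype)).comap (complexification Vh).subtype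

end Complexification

/-! ### Weighted `L²` functions, the Laplace transform and the Hardy space -/

section Laplace

/-- `u ∈ L²_α(ℝ₊; X)`, that is, `u` is measurable and `∫₀^∞ ‖u(t)‖² e^{-2αt} dt < ⊤`. -/
def MemWeightedL2 {X : Type} [NormedAddCommGroup X] (α : ℝ) (u : ℝ → X) : Prop :=
  AEStronglyMeasurable u (volume.restrict (Set.Ioi 0)) ∧
    ∫⁻ t in Set.Ioi (0 : ℝ), ‖u t‖ₑ ^ 2 * ENNReal.ofReal (Real.exp (-2 * α * t)) < ⊤

/-- The Laplace transform `s ↦ ∫₀^∞ e^{-st} f(t) dt`. -/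
def laplaceTransform {X : Type} [NormedAddCommGroup X] [NormedSpace ℂ X] (f : ℝ → X) (s : ℂ) : X :=
  ∫ t in Set.Ioi (0 : ℝ), Complex.exp (-s * t) • f t

/-- The point `σ + iτ`. -/
def linePoint (σ τ : ℝ) : ℂ := σ + Complex.I * τ

/-- The norm of `ℋ²_α(X)`: the supremum over `σ > α` of `(∫ ‖F(σ + iτ)‖² dτ / 2π)^{1/2}`. -/
def hardyNorm {X : Type} [NormedAddCommGroup X] (α : ℝ) (F : ℂ → X) : ℝ≥0∞ :=
  ⨆ σ ∈ Set.Ioi α,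
    (∫⁻ τ : ℝ, ‖F (linePoint σ τ)‖ₑ ^ 2 / ENNReal.ofReal (2 * Real.pi)) ^ (1 / 2 : ℝ)

/-- The boundary value `F(α + iτ) = lim_{σ → α+} F(σ + iτ)` of a function on `{Re s > α}`. -/
def boundaryValue {X : Type} [NormedAddCommGroup X] (α : ℝ) (F : ℂ → X) (τ : ℝ) : X :=
  limUnder (𝓝[>] α) fun σ => F (linePoint σ τ)

/-- `F ∈ ℋ²_α(X)`: `F` is holomorphic in `{Re s > α}`, its Hardy norm is finite, its boundary values
exist almost everywhere, and they are square integrable. -/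
def MemHardy {X : Type} [NormedAddCommGroup X] [NormedSpace ℂ X] (α : ℝ) (F : ℂ → X) : Prop :=
  DifferentiableOn ℂ F {s | α < s.re} ∧ hardyNorm α F < ⊤ ∧
    (∀ᵐ τ : ℝ, Tendsto (fun σ => F (linePoint σ τ)) (𝓝[>] α) (𝓝 (boundaryValue α F τ))) ∧
    ∫⁻ τ : ℝ, ‖boundaryValue α F τ‖ₑ ^ 2 < ⊤

end Laplace

/-! ### The two minimization problems -/

section ReducedBasis

/-- The set of minimizers of `J` over `S`. -/
def argmin {β : Type} (J : β → ℝ≥0∞) (S : Set β) : Set β := {x | x ∈ S ∧ IsMinOn J S x}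

variable {d : ℕ} [NeZero d] {Ω : BoundedOpen d} (Vh : Submodule ℝ (H10 Ω ℝ))

/-- `û_h = ℒ{u_h}`, with values in `V_h^ℂ`. -/
def uHat (u : ℝ → Vh) : ℂ → complexification Vh :=
  laplaceTransform fun t => toComplex Vh (u t)

/-- The minimizers of `‖û_h - P_X û_h‖²` in the norm of `ℋ²_α(H¹₀(Ω))` among the complex subspaces
`X ⊆ V_h^ℂ` with `dim_ℂ X ≤ R`. -/
def laplaceArgmin [FiniteDimensional ℝ Vh] (α : ℝ) (u : ℝ → Vh) (R : ℕ) :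
    Set (Submodule ℂ (complexification Vh)) :=
  argmin (fun X => hardyNorm α (fun s => uHat Vh u s - X.starProjection (uHat Vh u s)) ^ 2)
    {X | Module.finrank ℂ X ≤ R}

/-- The minimizers of `∫ ‖Re û_h(α + iτ) - P_V Re û_h(α + iτ)‖² dτ` among the real subspaces
`V ⊆ V_h` with `dim_ℝ V ≤ R`. -/
def realArgmin [FiniteDimensional ℝ Vh] (α : ℝ) (u : ℝ → Vh) (R : ℕ) : Set (Submodule ℝ Vh) :=
  argmin (fun V => ∫⁻ τ : ℝ,
      ‖complexToReal Vh (boundaryValue α (uHat Vh u) τ) -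
        V.starProjection (complexToReal Vh (boundaryValue α (uHat Vh u) τ))‖ₑ ^ 2)
    {V | Module.finrank ℝ V ≤ R}

end ReducedBasis

end

/-! Put `g(t) = e^{-αt} u(t)` for `t > 0` and `g(t) = 0` for `t ≤ 0`, a square integrable function
with values in the real space. On the line `Re s = α + ε` the Laplace transform is the Fourier
integral of `e^{-ε|t|} g(t)`, so Plancherel turns the Hardy error of a complex subspace `X` into `∫
‖g - P_X g‖² dt`. Since `u` is real, the real part of the transform is the Fourier integral of the
even part of `g`, and since `g` lives on `t > 0`, that part carries exactly half of the energy.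
Hence the cost of `V` in the real problem is `π` times the Hardy cost of `V^ℂ`
(`lintegral_enorm_sq_re_boundaryValue`): the real problem is the complex one restricted to
complexified subspaces.

It remains to see that complexified subspaces suffice. The covariance operator of `g` is real and
symmetric. With a real orthonormal eigenbasis `e i` and eigenvalues `c i ≥ 0`, the error of `X` is
`∑ c i (1 - a i)`, where `a i = ‖P_X e i‖²` lies in `[0, 1]` and `∑ a i = dim X ≤ R`. This is a
linear program over a truncated cube (`exists_vertex_max`). It is solved by the indicator of a set
`S`, which is realized by the span of the `e i`, `i ∈ S`, a real space. If the real minimizer is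
unique, so is the optimal set `S`, and then the program has no other solution; every complex
minimizer has weights `0` and `1` and is therefore that same space. Conversely, uniqueness descends
because complexification is injective (`argmin_complexSpan`).

The analytic input is the almost everywhere existence of boundary values: the Abel means of a
Fourier integral are Poisson integrals of the `L²` Fourier transform, and these converge at Lebesgue
points (`ae_tendsto_integral_poissonLine`, `exists_ae_tendsto_abelFourier`). -/

noncomputable section

open MeasureTheory Filter Topology
open scoped ENNReal ContDiff


/-! ### Maximizing a linear functional over the hypersimplex -/

section Hypersimplex

variable {n : Type*} [Fintype n] [DecidableEq n]

/-- The fractional weights `a ∈ [0, 1]^n` with `∑ a ≤ R` are dominated by the vertex `S`, strictly so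
if there is a gap at the threshold `θ`. -/
theorem sum_mul_le_sum_of_threshold {c a : n → ℝ} {S : Finset n} {R : ℕ} {θ : ℝ}
    (hθ : 0 ≤ θ) (hR : θ * R = θ * S.card) (hS : ∀ i ∈ S, θ ≤ c i) (hSc : ∀ i ∉ S, c i ≤ θ)
    (h0 : ∀ i, 0 ≤ a i) (h1 : ∀ i, a i ≤ 1) (ha : ∑ i, a i ≤ R) :
    ∑ i, c i * a i ≤ ∑ i ∈ S, c i ∧
      ((∀ i ∈ S, θ < c i) → ∑ i, c i * a i = ∑ i ∈ S, c i → ∀ i ∈ S, a i = 1) := by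
  set χ : n → ℝ := fun i => if i ∈ S then 1 else 0 with hχ
  have hsum : ∑ i ∈ S, c i = ∑ i, c i * χ i := by simp [hχ]
  have hcard : ∑ i, χ i = S.card := by simp [hχ]
  have hterm : ∀ i ∈ Finset.univ, (c i - θ) * (a i - χ i) ≤ 0 := by
    intro i _
    by_cases hi : i ∈ S
    · simp only [hχ, hi, if_true]
      exact mul_nonpos_of_nonneg_of_nonpos (by linarith [hS i hi]) (by linarith [h1 i])
    · simp only [hχ, hi, if_false, sub_zero]
      exact mul_nonpos_of_nonpos_of_nonneg (by linarith [hSc i hi]) (h0 i)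
  -- Linear programming duality with multiplier `θ` for the budget: both terms on the right are
  -- nonpositive, the second because `hR` is complementary slackness (`θ = 0` or `S` has exactly `R`
  -- elements).
  have hsplit : ∑ i, c i * a i - ∑ i, c i * χ i
      = ∑ i, (c i - θ) * (a i - χ i) + θ * (∑ i, a i - ∑ i, χ i) := by
    rw [← Finset.sum_sub_distrib, ← Finset.sum_sub_distrib, Finset.mul_sum,
      ← Finset.sum_add_distrib]
    exact Finset.sum_congr rfl fun i _ => by ring
  have hθ' : θ * (∑ i, a i - ∑ i, χ i) ≤ 0 := by
    rw [hcard, mul_sub, ← hR, ← mul_sub]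
    exact mul_nonpos_of_nonneg_of_nonpos hθ (by linarith)
  have hneg := Finset.sum_nonpos hterm
  refine ⟨by rw [hsum]; linarith, fun hlt heq i hi => ?_⟩
  have hz : ∑ i, (c i - θ) * (a i - χ i) = 0 := by rw [hsum] at heq; linarith
  have := (Finset.sum_eq_zero_iff_of_nonpos hterm).mp hz i (Finset.mem_univ i)
  simp only [hχ, hi, if_true] at this
  rcases mul_eq_zero.mp this with h | h
  · linarith [hlt i hi]
  · linarith

/-- A linear functional with nonnegative coefficients attains its maximum over
`{a ∈ [0, 1]^n | ∑ a ≤ R}` at a vertex `S`, and nowhere else if no other vertex attains it. -/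
theorem exists_vertex_max (c : n → ℝ) (hc : ∀ i, 0 ≤ c i) (R : ℕ) :
    ∃ S : Finset n, S.card ≤ R ∧
      ∀ a : n → ℝ, (∀ i, 0 ≤ a i) → (∀ i, a i ≤ 1) → ∑ i, a i ≤ R →
        ∑ i, c i * a i ≤ ∑ i ∈ S, c i ∧
        ((∀ T : Finset n, T.card ≤ R → ∑ i ∈ T, c i = ∑ i ∈ S, c i → T = S) →
          ∑ i, c i * a i = ∑ i ∈ S, c i → ∀ i, a i = if i ∈ S then 1 else 0) := by
  -- `S` is a best set of at most `R` indices. Comparing it with the sets obtained by inserting,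
  -- exchanging or deleting one index yields the threshold.
  obtain ⟨S, hS, hmax⟩ := Finset.exists_max_image
    (Finset.univ.filter fun T : Finset n => T.card ≤ R) (fun T => ∑ i ∈ T, c i) ⟨∅, by simp⟩
  simp only [Finset.mem_filter, Finset.mem_univ, true_and] at hS hmax
  have hins : ∀ j ∉ S, S.card < R → c j = 0 ∧ ∑ i ∈ insert j S, c i = ∑ i ∈ S, c i := by
    intro j hj hlt
    have h := hmax (insert j S) (by rw [Finset.card_insert_of_notMem hj]; omega)
    rw [Finset.sum_insert hj] at h ⊢
    have : c j = 0 := le_antisymm (by linarith) (hc j)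
    exact ⟨this, by rw [this, zero_add]⟩
  have hswap_card : ∀ i ∈ S, ∀ j ∉ S, (insert j (S.erase i)).card ≤ R := by
    intro i hi j hj
    rw [Finset.card_insert_of_notMem (fun h => hj (Finset.mem_of_mem_erase h)),
      Finset.card_erase_add_one hi]
    exact hS
  have hswap_sum : ∀ i ∈ S, ∀ j ∉ S, ∑ k ∈ insert j (S.erase i), c k = c j + ∑ k ∈ S, c k - c i := by
    intro i hi j hj
    rw [Finset.sum_insert (fun h => hj (Finset.mem_of_mem_erase h)), ← Finset.add_sum_erase S c hi]
    ring
  have hex : ∀ i ∈ S, ∀ j ∉ S, c j ≤ c i := by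
    intro i hi j hj
    have h := hmax _ (hswap_card i hi j hj)
    rw [hswap_sum i hi j hj] at h
    linarith
  have hpos : (∀ T : Finset n, T.card ≤ R → ∑ i ∈ T, c i = ∑ i ∈ S, c i → T = S) →
      ∀ i ∈ S, 0 < c i := by
    intro huniq i hi
    refine lt_of_le_of_ne (hc i) fun h => ?_
    have h' := huniq (S.erase i) ((Finset.card_le_card (Finset.erase_subset i S)).trans hS)
      (by rw [← Finset.add_sum_erase S c hi, ← h, zero_add])
    have h'' := Finset.notMem_erase i S
    rw [h'] at h''
    exact h'' hi
  -- The threshold is `0` if `S` is everything, and otherwise the largest coefficient outside `S`.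
  -- If `S` is the only optimal set, a tie at the threshold is impossible (exchange the two
  -- indices), and so is an unspent budget with `S ≠ univ` (insert an index of coefficient zero).
  obtain ⟨θ, hθ, hθR, hθS, hθSc, hθu⟩ : ∃ θ : ℝ, 0 ≤ θ ∧ θ * R = θ * S.card ∧ (∀ i ∈ S, θ ≤ c i) ∧
      (∀ i ∉ S, c i ≤ θ) ∧
      ((∀ T : Finset n, T.card ≤ R → ∑ i ∈ T, c i = ∑ i ∈ S, c i → T = S) →
        (∀ i ∈ S, θ < c i) ∧ (S.card = R ∨ S = Finset.univ)) := by
    by_cases hu : S = Finset.univ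
    · exact ⟨0, le_rfl, by simp, fun i _ => hc i, fun i hi => absurd (hu ▸ Finset.mem_univ i) hi,
        fun h => ⟨hpos h, Or.inr hu⟩⟩
    · have hne : Sᶜ.Nonempty := by
        rwa [Finset.nonempty_iff_ne_empty, ne_eq, Finset.compl_eq_empty_iff]
      obtain ⟨j, hj, hjmax⟩ := Finset.exists_max_image Sᶜ c hne
      simp only [Finset.mem_compl] at hj hjmax
      refine ⟨c j, hc j, ?_, fun i hi => hex i hi j hj, hjmax, fun huniq => ⟨fun i hi => ?_, ?_⟩⟩
      · rcases hS.lt_or_eq with h | h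
        · rw [(hins j hj h).1, zero_mul, zero_mul]
        · rw [h]
      · refine lt_of_le_of_ne (hex i hi j hj) fun h => hj ?_
        have := huniq _ (hswap_card i hi j hj) (by rw [hswap_sum i hi j hj, h]; ring)
        rw [← this]
        exact Finset.mem_insert_self _ _
      · rcases hS.lt_or_eq with h | h
        · exfalso
          have := huniq (insert j S) (by rw [Finset.card_insert_of_notMem hj]; omega)
            (hins j hj h).2
          exact hj (this ▸ Finset.mem_insert_self _ _)
        · exact Or.inl h
  refine ⟨S, hS, fun a h0 h1 ha => ?_⟩
  obtain ⟨hle, heq1⟩ := sum_mul_le_sum_of_threshold hθ hθR hθS hθSc h0 h1 ha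
  refine ⟨hle, fun huniq heq => ?_⟩
  obtain ⟨hlt, hcase⟩ := hθu huniq
  have hone := heq1 hlt heq
  -- If `S` has `R` elements, the ones on `S` already exhaust the budget.
  have hzero : ∀ i ∉ S, a i = 0 := by
    rcases hcase with h | h
    · have hs : ∑ i ∈ S, a i = R := by
        rw [Finset.sum_congr rfl hone]; simp [h]
      have hsc : ∑ i ∈ Sᶜ, a i = 0 := by
        refine le_antisymm ?_ (Finset.sum_nonneg fun i _ => h0 i)
        have := Finset.sum_add_sum_compl S a
        linarith
      intro i hi
      exact (Finset.sum_eq_zero_iff_of_nonneg fun i _ => h0 i).mp hsc i (Finset.mem_compl.mpr hi)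
    · intro i hi
      exact absurd (h ▸ Finset.mem_univ i) hi
  intro i
  by_cases hi : i ∈ S
  · simp [hi, hone i hi]
  · simp [hi, hzero i hi]

end Hypersimplex

/-! ### Complexifications of real inner product spaces -/

section Complexification

open Complex

variable {H E : Type*} [NormedAddCommGroup H] [InnerProductSpace ℝ H]
  [NormedAddCommGroup E] [InnerProductSpace ℂ E]

/-- `ι : H → E` exhibits the complex inner product space `E` as the complexification of `H`. -/
structure IsComplexification (ι : H →ₗ[ℝ] E) : Prop where
  inner_map : ∀ v w, inner ℂ (ι v) (ι w) = ((inner ℝ v w : ℝ) : ℂ)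
  exists_eq : ∀ x, ∃ v w, x = ι v + I • ι w

/-- The complex span `{v + i w : v, w ∈ V}` of a real subspace. -/
def complexSpan (ι : H →ₗ[ℝ] E) (V : Submodule ℝ H) : Submodule ℂ E :=
  Submodule.span ℂ (ι '' (V : Set H))

namespace IsComplexification

variable {ι : H →ₗ[ℝ] E} (hι : IsComplexification ι)
include hι

theorem norm_map (v : H) : ‖ι v‖ = ‖v‖ := by
  have h := hι.inner_map v v
  rw [inner_self_eq_norm_sq_to_K, real_inner_self_eq_norm_sq] at h
  have h' : ‖ι v‖ ^ 2 = ‖v‖ ^ 2 := Complex.ofReal_injective (by simpa using h)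
  exact (sq_eq_sq₀ (norm_nonneg _) (norm_nonneg _)).mp h'

theorem injective : Function.Injective ι := by
  rw [injective_iff_map_eq_zero]
  intro v hv
  rw [← norm_eq_zero, ← hι.norm_map, hv, norm_zero]

theorem orthonormal {n : Type*} {e : n → H} (he : Orthonormal ℝ e) :
    Orthonormal ℂ fun i => ι (e i) := by
  classical
  rw [orthonormal_iff_ite] at he ⊢
  intro i j
  rw [hι.inner_map, he i j]
  split_ifs <;> simp

end IsComplexification

theorem complexSpan_span (ι : H →ₗ[ℝ] E) (s : Set H) :
    complexSpan ι (Submodule.span ℝ s) = Submodule.span ℂ (ι '' s) := by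
  refine le_antisymm (Submodule.span_le.mpr ?_)
    (Submodule.span_mono (Set.image_mono Submodule.subset_span))
  rintro _ ⟨v, hv, rfl⟩
  induction hv using Submodule.span_induction with
  | mem x hx => exact Submodule.subset_span ⟨x, hx, rfl⟩
  | zero => simp
  | add x y _ _ hx hy => rw [map_add]; exact Submodule.add_mem _ hx hy
  | smul c x _ hx => rw [map_smul]; exact Submodule.smul_mem _ (c : ℂ) hx

namespace IsComplexification

variable {ι : H →ₗ[ℝ] E} (hι : IsComplexification ι)
include hι

theorem complexSpan_top : complexSpan ι ⊤ = ⊤ := by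
  refine eq_top_iff.mpr fun x _ => ?_
  obtain ⟨v, w, rfl⟩ := hι.exists_eq x
  exact Submodule.add_mem _ (Submodule.subset_span ⟨v, trivial, rfl⟩)
    (Submodule.smul_mem _ _ (Submodule.subset_span ⟨w, trivial, rfl⟩))

/-- A real orthonormal basis of `V` stays orthonormal over `ℂ` and spans the complexification. -/
theorem finrank_complexSpan (V : Submodule ℝ H) [FiniteDimensional ℝ V] :
    Module.finrank ℂ (complexSpan ι V) = Module.finrank ℝ V := by
  set b := stdOrthonormalBasis ℝ V
  have hV : V = Submodule.span ℝ (Set.range fun i => (b i : H)) := by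
    have := congrArg (Submodule.map V.subtype) b.toBasis.span_eq
    rw [Submodule.map_span, ← Set.range_comp, Submodule.map_top, Submodule.range_subtype] at this
    simpa [Function.comp_def] using this.symm
  have ho : Orthonormal ℝ fun i => (b i : H) := b.orthonormal.comp_linearIsometry V.subtypeₗᵢ
  have h2 : complexSpan ι V = Submodule.span ℂ (Set.range fun i => ι (b i : H)) := by
    conv_lhs => rw [hV]
    rw [complexSpan_span, ← Set.range_comp]
    rfl
  rw [h2, finrank_span_eq_card (hι.orthonormal ho).linearIndependent, Fintype.card_fin]

/-- The residual of the real projection is orthogonal to `ι '' V`, hence to its complex span. This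
makes the real and the complex projection errors of a real vector equal. -/
theorem starProjection_complexSpan [FiniteDimensional ℝ H] [FiniteDimensional ℂ E]
    (V : Submodule ℝ H) (v : H) :
    (complexSpan ι V).starProjection (ι v) = ι (V.starProjection v) := by
  refine Submodule.eq_starProjection_of_mem_of_inner_eq_zero
    (Submodule.subset_span ⟨_, Submodule.starProjection_apply_mem V v, rfl⟩) fun w hw => ?_
  rw [← map_sub]
  induction hw using Submodule.span_induction with
  | mem x hx =>
    obtain ⟨y, hy, rfl⟩ := hx
    rw [hι.inner_map, Submodule.starProjection_inner_eq_zero v y hy, ofReal_zero]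
  | zero => simp
  | add x y _ _ hx hy => rw [inner_add_right, hx, hy, add_zero]
  | smul c x _ hx => rw [inner_smul_right, hx, mul_zero]

/-- `V` is recovered as the set of real vectors fixed by the projection onto its complexification.
-/
theorem complexSpan_injective [FiniteDimensional ℝ H] [FiniteDimensional ℂ E] :
    Function.Injective (complexSpan ι) := by
  have key : ∀ V W : Submodule ℝ H, complexSpan ι V = complexSpan ι W → V ≤ W := by
    intro V W h v hv
    have h1 : (complexSpan ι W).starProjection (ι v) = ι v := by
      rw [Submodule.starProjection_eq_self_iff, ← h]
      exact Submodule.subset_span ⟨v, hv, rfl⟩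
    rw [hι.starProjection_complexSpan] at h1
    exact Submodule.starProjection_eq_self_iff.mp (hι.injective h1)
  exact fun V W h => le_antisymm (key V W h) (key W V h.symm)

end IsComplexification

end Complexification

open MeasureTheory Filter Topology
open scoped ENNReal ContDiff


/-! ### The covariance operator -/

theorem enorm_sq_eq_ofReal {X : Type*} [SeminormedAddCommGroup X] (x : X) :
    ‖x‖ₑ ^ 2 = ENNReal.ofReal (‖x‖ ^ 2) := by
  rw [ENNReal.ofReal_pow (norm_nonneg _), ofReal_norm]

section Covariance

variable {H : Type*} [NormedAddCommGroup H] [InnerProductSpace ℝ H]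
  {T : Type*} [MeasurableSpace T] {μ : Measure T} {g : T → H}

theorem integrable_inner_mul_inner (hg : MemLp g 2 μ) (v w : H) :
    Integrable (fun t => inner ℝ (g t) v * inner ℝ (g t) w) μ :=
  (hg.inner_const v).integrable_mul (hg.inner_const w)

theorem integrable_inner_smul (hg : MemLp g 2 μ) (v : H) :
    Integrable (fun t => (inner ℝ (g t) v : ℝ) • g t) μ := by
  have h := (memLp_one_iff_integrable (μ := μ) (f := fun t => (inner ℝ (g t) v : ℝ) • g t)).mp
    (hg.smul (hg.inner_const v))
  exact h

/-- The covariance operator `v ↦ ∫ ⟪g, v⟫ g`. -/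
def covarianceOperator (hg : MemLp g 2 μ) : H →ₗ[ℝ] H where
  toFun v := ∫ t, (inner ℝ (g t) v : ℝ) • g t ∂μ
  map_add' v w := by
    rw [← integral_add (integrable_inner_smul hg v) (integrable_inner_smul hg w)]
    simp only [inner_add_right, add_smul]
  map_smul' c v := by
    rw [RingHom.id_apply, ← integral_smul]
    simp only [inner_smul_right, mul_smul]

theorem inner_covarianceOperator [CompleteSpace H] (hg : MemLp g 2 μ) (v w : H) :
    inner ℝ w (covarianceOperator hg v) = ∫ t, inner ℝ (g t) v * inner ℝ (g t) w ∂μ := by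
  have h : covarianceOperator hg v = ∫ t, (inner ℝ (g t) v : ℝ) • g t ∂μ := rfl
  rw [h, ← integral_inner (integrable_inner_smul hg v)]
  simp only [inner_smul_right, real_inner_comm w]

/-- The eigenbasis of the covariance operator diagonalizes all quadratic functionals
`∫ ‖L g‖²`. -/
theorem exists_orthonormalBasis_lintegral_enorm_sq [FiniteDimensional ℝ H] (hg : MemLp g 2 μ) :
    ∃ (e : OrthonormalBasis (Fin (Module.finrank ℝ H)) ℝ H) (c : Fin (Module.finrank ℝ H) → ℝ),
      (∀ i, 0 ≤ c i) ∧
      ∀ {F : Type} [NormedAddCommGroup F] [InnerProductSpace ℝ F] (L : H →ₗ[ℝ] F),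
        ∫⁻ t, ‖L (g t)‖ₑ ^ 2 ∂μ = ENNReal.ofReal (∑ i, c i * ‖L (e i)‖ ^ 2) := by
  have hsymm : (covarianceOperator hg).IsSymmetric := by
    intro v w
    rw [real_inner_comm, inner_covarianceOperator, inner_covarianceOperator]
    simp only [mul_comm]
  set e := hsymm.eigenvectorBasis rfl with he
  have hdiag : ∀ i j, ∫ t, inner ℝ (g t) (e i) * inner ℝ (g t) (e j) ∂μ
      = if i = j then hsymm.eigenvalues rfl i else 0 := by
    intro i j
    rw [← inner_covarianceOperator hg, he, hsymm.apply_eigenvectorBasis, inner_smul_right,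
      orthonormal_iff_ite.mp (hsymm.eigenvectorBasis rfl).orthonormal j i]
    simp [eq_comm]
  refine ⟨e, hsymm.eigenvalues rfl, fun i => ?_, fun {F} _ _ L => ?_⟩
  · have h := hdiag i i
    rw [if_pos rfl] at h
    rw [← h]
    exact integral_nonneg fun t => mul_self_nonneg _
  -- Expand `g t` in the eigenbasis; by `hdiag` the cross terms integrate to zero. The basis and the
  -- coefficients do not depend on `L`, so all subspaces are treated at once.
  · have hexp : ∀ t, ‖L (g t)‖ ^ 2 = ∑ i, ∑ j,
        inner ℝ (g t) (e i) * inner ℝ (g t) (e j) * inner ℝ (L (e i)) (L (e j)) := by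
      intro t
      have h : L (g t) = ∑ i, (inner ℝ (g t) (e i) : ℝ) • L (e i) := by
        conv_lhs => rw [← e.sum_repr' (g t)]
        simp only [map_sum, map_smul, real_inner_comm]
      rw [← real_inner_self_eq_norm_sq, h, sum_inner]
      refine Finset.sum_congr rfl fun i _ => ?_
      rw [inner_sum]
      refine Finset.sum_congr rfl fun j _ => ?_
      rw [real_inner_smul_left, inner_smul_right]
      ring
    have hint : ∀ i j, Integrable (fun t =>
        inner ℝ (g t) (e i) * inner ℝ (g t) (e j) * inner ℝ (L (e i)) (L (e j))) μ := fun i j =>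
      (integrable_inner_mul_inner hg (e i) (e j)).mul_const _
    simp only [enorm_sq_eq_ofReal]
    rw [← ofReal_integral_eq_lintegral_ofReal]
    · congr 1
      simp only [hexp]
      rw [integral_finsetSum _ fun i _ => integrable_finsetSum _ fun j _ => hint i j]
      refine Finset.sum_congr rfl fun i _ => ?_
      rw [integral_finsetSum _ fun j _ => hint i j]
      simp only [integral_mul_const, hdiag, ite_mul, zero_mul, Finset.sum_ite_eq, Finset.mem_univ,
        if_true, real_inner_self_eq_norm_sq]
    · simp only [hexp]
      exact integrable_finsetSum _ fun i _ => integrable_finsetSum _ fun j _ => hint i j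
    · exact Eventually.of_forall fun t => sq_nonneg _

end Covariance

/-! ### Projections and orthonormal bases -/

section Projections

variable {E : Type*} [NormedAddCommGroup E] [InnerProductSpace ℂ E] [FiniteDimensional ℂ E]

theorem norm_sub_starProjection_sq (X : Submodule ℂ E) (x : E) :
    ‖x - X.starProjection x‖ ^ 2 = ‖x‖ ^ 2 - ‖X.starProjection x‖ ^ 2 := by
  have h := X.norm_sq_eq_add_norm_sq_starProjection x
  rw [Submodule.starProjection_orthogonal_val] at h
  linarith

theorem norm_starProjection_sq_le (X : Submodule ℂ E) (x : E) :
    ‖X.starProjection x‖ ^ 2 ≤ ‖x‖ ^ 2 := by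
  have := norm_sub_starProjection_sq X x
  nlinarith [sq_nonneg ‖x - X.starProjection x‖]

/-- Both sides are the trace of the projection: expand in an orthonormal basis of `X`, exchange the
sums and apply Parseval to each of its unit vectors. -/
theorem sum_norm_sq_starProjection {n : Type*} [Fintype n] (b : OrthonormalBasis n ℂ E)
    (X : Submodule ℂ E) : ∑ i, ‖X.starProjection (b i)‖ ^ 2 = Module.finrank ℂ X := by
  set f := stdOrthonormalBasis ℂ X
  have h : ∀ i, ‖X.starProjection (b i)‖ ^ 2 = ∑ k, ‖inner ℂ (f k : E) (b i)‖ ^ 2 := by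
    intro i
    rw [Submodule.starProjection_apply, ← Submodule.coe_norm, ← f.sum_sq_norm_inner_right]
    exact Finset.sum_congr rfl fun k _ => by
      rw [Submodule.inner_orthogonalProjectionOnto_eq_of_mem_left]
  simp only [h]
  rw [Finset.sum_comm]
  simp only [b.sum_sq_norm_inner_left]
  have : ∀ k, ‖(f k : E)‖ = 1 := fun k => f.orthonormal.1 k
  simp [this]

end Projections

/-! ### Minimizers over complex and over real subspaces -/

namespace IsComplexification

section Basis

variable {H E : Type*} [NormedAddCommGroup H] [InnerProductSpace ℝ H]
  [NormedAddCommGroup E] [InnerProductSpace ℂ E] {ι : H →ₗ[ℝ] E} (hι : IsComplexification ι)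
  {n : Type*} [Fintype n] (e : OrthonormalBasis n ℝ H)

/-- An orthonormal basis of the real space is one of its complexification. -/
def basis : OrthonormalBasis n ℂ E :=
  OrthonormalBasis.mk (hι.orthonormal e.orthonormal) (by
    have h := complexSpan_span ι (Set.range e)
    rw [← e.coe_toBasis, e.toBasis.span_eq, hι.complexSpan_top, e.coe_toBasis,
      ← Set.range_comp] at h
    exact h.le)

theorem basis_apply (i : n) : hι.basis e i = ι (e i) := by
  simp [basis]

variable [FiniteDimensional ℝ H] [FiniteDimensional ℂ E]

include hι

theorem starProjection_span_image (S : Finset n) [DecidableEq n] (i : n) :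
    (complexSpan ι (Submodule.span ℝ (e '' S))).starProjection (ι (e i))
      = if i ∈ S then ι (e i) else 0 := by
  rw [hι.starProjection_complexSpan]
  split_ifs with h
  · have hmem : e i ∈ Submodule.span ℝ (e '' S) := Submodule.subset_span ⟨i, h, rfl⟩
    rw [Submodule.starProjection_eq_self_iff.mpr hmem]
  · rw [← map_zero ι]
    congr 1
    refine Submodule.eq_starProjection_of_mem_of_inner_eq_zero (Submodule.zero_mem _) fun w hw => ?_
    rw [sub_zero]
    induction hw using Submodule.span_induction with
    | mem x hx =>
      obtain ⟨j, hj, rfl⟩ := hx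
      exact e.orthonormal.2 fun hij => h (hij ▸ hj)
    | zero => simp
    | add x y _ _ hx hy => rw [inner_add_right, hx, hy, add_zero]
    | smul c x _ hx => rw [inner_smul_right, hx, mul_zero]

theorem norm_sq_starProjection_span_image (S : Finset n) [DecidableEq n] (i : n) :
    ‖(complexSpan ι (Submodule.span ℝ (e '' S))).starProjection (ι (e i))‖ ^ 2
      = if i ∈ S then 1 else 0 := by
  rw [hι.starProjection_span_image]
  split_ifs <;> simp [hι.norm_map]

omit [FiniteDimensional ℝ H] in
-- Weight `0` means that the basis vector is orthogonal to `X`, weight `1` that it lies in `X` by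
-- Pythagoras. Weights at a vertex of the cube thus determine the subspace.
theorem eq_complexSpan_of_norm_sq_starProjection {X : Submodule ℂ E} {S : Finset n} [DecidableEq n]
    (h : ∀ i, ‖X.starProjection (ι (e i))‖ ^ 2 = if i ∈ S then 1 else 0) :
    X = complexSpan ι (Submodule.span ℝ (e '' S)) := by
  rw [complexSpan_span]
  refine le_antisymm (fun x hx => ?_) (Submodule.span_le.mpr ?_)
  · rw [← (hι.basis e).sum_repr' x]
    refine Submodule.sum_mem _ fun i _ => ?_
    rw [hι.basis_apply]
    by_cases hi : i ∈ S
    · exact Submodule.smul_mem _ _ (Submodule.subset_span ⟨_, ⟨i, hi, rfl⟩, rfl⟩)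
    · have h0 : X.starProjection (ι (e i)) = 0 := by
        have := h i
        rw [if_neg hi] at this
        exact norm_eq_zero.mp (pow_eq_zero_iff two_ne_zero |>.mp this)
      have : inner ℂ (ι (e i)) x = 0 := by
        rw [← Submodule.starProjection_eq_self_iff.mpr hx,
          ← Submodule.inner_starProjection_left_eq_right, h0, inner_zero_left]
      rw [this, zero_smul]
      exact Submodule.zero_mem _
  · rintro _ ⟨_, ⟨i, hi, rfl⟩, rfl⟩
    have h1 := norm_sub_starProjection_sq X (ι (e i))
    rw [h i, if_pos (Finset.mem_coe.mp hi), hι.norm_map, e.orthonormal.1, one_pow, sub_self] at h1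
    have h2 := sub_eq_zero.mp (norm_eq_zero.mp (pow_eq_zero_iff two_ne_zero |>.mp h1))
    exact Submodule.starProjection_eq_self_iff.mp h2.symm

end Basis

/-- Real and complex subspaces of dimension at most `R` minimizing the projection error of a
quadratic functional that is diagonal in a real orthonormal basis. -/
theorem argmin_complexSpan {H E : Type} [NormedAddCommGroup H] [InnerProductSpace ℝ H]
    [NormedAddCommGroup E] [InnerProductSpace ℂ E] [FiniteDimensional ℝ H] [FiniteDimensional ℂ E]
    {ι : H →ₗ[ℝ] E} (hι : IsComplexification ι) {n : Type*} [Fintype n]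
    (e : OrthonormalBasis n ℝ H) {c : n → ℝ} (hc : ∀ i, 0 ≤ c i) (R : ℕ)
    {J : Submodule ℂ E → ℝ≥0∞} {K : Submodule ℝ H → ℝ≥0∞}
    (hJ : ∀ X, J X = ENNReal.ofReal (∑ i, c i * ‖ι (e i) - X.starProjection (ι (e i))‖ ^ 2))
    {k : ℝ≥0∞} (hk : k ≠ 0) (hk' : k ≠ ⊤) (hK : ∀ V, K V = k * J (complexSpan ι V)) :
    (argmin J {X | Module.finrank ℂ X ≤ R}).Nonempty ∧
    (argmin K {V | Module.finrank ℝ V ≤ R}).Nonempty ∧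
    (∀ V, complexSpan ι V ∈ argmin J {X | Module.finrank ℂ X ≤ R} ↔
      V ∈ argmin K {V | Module.finrank ℝ V ≤ R}) ∧
    (∀ W, argmin J {X | Module.finrank ℂ X ≤ R} = {W} ↔
      ∃ V, argmin K {V | Module.finrank ℝ V ≤ R} = {V} ∧ W = complexSpan ι V) := by
  classical
  have hKle : ∀ V W, K V ≤ K W ↔ J (complexSpan ι V) ≤ J (complexSpan ι W) := by
    intro V W
    rw [hK, hK, ENNReal.mul_le_mul_iff_right hk hk']
  obtain ⟨S, hSR, hS⟩ := exists_vertex_max c hc R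
  -- These weights are the feasible point of the linear program attached to `X`; minimizing `J`
  -- means maximizing `∑ c i * a X i`.
  set a : Submodule ℂ E → n → ℝ := fun X i => ‖X.starProjection (ι (e i))‖ ^ 2 with ha
  have ha1 : ∀ X i, a X i ≤ 1 := fun X i => by
    have := norm_starProjection_sq_le X (ι (e i))
    rwa [hι.norm_map, e.orthonormal.1, one_pow] at this
  have hasum : ∀ X, ∑ i, a X i = Module.finrank ℂ X := fun X => by
    rw [← sum_norm_sq_starProjection (hι.basis e) X]
    simp only [ha, hι.basis_apply]
  have hJa : ∀ X, J X = ENNReal.ofReal (∑ i, c i - ∑ i, c i * a X i) := fun X => by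
    rw [hJ, ← Finset.sum_sub_distrib]
    congr 1
    refine Finset.sum_congr rfl fun i _ => ?_
    rw [norm_sub_starProjection_sq, hι.norm_map, e.orthonormal.1]
    ring
  -- Needed because `ENNReal.ofReal` truncates at zero and would otherwise lose the comparison.
  have hJnn : ∀ X, 0 ≤ ∑ i, c i - ∑ i, c i * a X i := fun X => by
    rw [← Finset.sum_sub_distrib]
    exact Finset.sum_nonneg fun i _ => by nlinarith [hc i, ha1 X i]
  have hJle : ∀ X Y, J X ≤ J Y ↔ ∑ i, c i * a Y i ≤ ∑ i, c i * a X i := fun X Y => by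
    rw [hJa, hJa, ENNReal.ofReal_le_ofReal_iff (hJnn Y)]
    constructor <;> intro h <;> linarith
  -- Every vertex of the program is realized by a real subspace.
  set v : Finset n → Submodule ℝ H := fun T => Submodule.span ℝ (e '' T) with hv
  have hav : ∀ T i, a (complexSpan ι (v T)) i = if i ∈ T then 1 else 0 := fun T i =>
    hι.norm_sq_starProjection_span_image e T i
  have hcv : ∀ T, ∑ i, c i * a (complexSpan ι (v T)) i = ∑ i ∈ T, c i := fun T => by
    simp [hav]
  have hvR : ∀ T : Finset n, T.card ≤ R → Module.finrank ℝ (v T) ≤ R := fun T hT => by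
    have h := finrank_span_finset_le_card (R := ℝ) (T.image e)
    rw [Finset.coe_image] at h
    exact (h.trans Finset.card_image_le).trans hT
  have hle : ∀ X : Submodule ℂ E, Module.finrank ℂ X ≤ R → ∑ i, c i * a X i ≤ ∑ i ∈ S, c i := fun X hX =>
    (hS (a X) (fun i => sq_nonneg _) (ha1 X) (by rw [hasum]; exact_mod_cast hX)).1
  have hmin : ∀ X : Submodule ℂ E, Module.finrank ℂ X ≤ R → J (complexSpan ι (v S)) ≤ J X := fun X hX => by
    rw [hJle, hcv]
    exact hle X hX
  have hJS : complexSpan ι (v S) ∈ argmin J {X | Module.finrank ℂ X ≤ R} := by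
    refine ⟨?_, fun X hX => hmin X hX⟩
    rw [Set.mem_ofPred_eq, hι.finrank_complexSpan]
    exact hvR S hSR
  have hiff : ∀ V, complexSpan ι V ∈ argmin J {X | Module.finrank ℂ X ≤ R} ↔
      V ∈ argmin K {V | Module.finrank ℝ V ≤ R} := by
    intro V
    constructor
    · rintro ⟨h1, h2⟩
      rw [Set.mem_ofPred_eq, hι.finrank_complexSpan] at h1
      refine ⟨h1, fun W hW => (hKle V W).mpr (h2 ?_)⟩
      rw [Set.mem_ofPred_eq, hι.finrank_complexSpan]
      exact hW
    · rintro ⟨h1, h2⟩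
      refine ⟨by rw [Set.mem_ofPred_eq, hι.finrank_complexSpan]; exact h1, fun X hX => ?_⟩
      -- A real minimizer does at least as well as `v S`, which in turn beats every complex
      -- competitor.
      exact ((hKle _ _).mp (h2 (hvR S hSR))).trans (hmin X hX)
  have hKS := (hiff _).mp hJS
  refine ⟨⟨_, hJS⟩, ⟨_, hKS⟩, hiff, fun W => ⟨fun hW => ?_, ?_⟩⟩
  · have hWS : complexSpan ι (v S) = W := by
      rw [hW] at hJS
      exact hJS
    refine ⟨v S, Set.eq_singleton_iff_unique_mem.mpr ⟨hKS, fun V hV => ?_⟩, hWS.symm⟩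
    have := (hiff V).mpr hV
    rw [hW, ← hWS] at this
    exact hι.complexSpan_injective this
  · rintro ⟨V, hV, rfl⟩
    have hVS : v S = V := by
      rw [hV] at hKS
      exact hKS
    rw [← hVS]
    refine Set.eq_singleton_iff_unique_mem.mpr ⟨hJS, fun X hX => ?_⟩
    refine hι.eq_complexSpan_of_norm_sq_starProjection e ?_
    refine (hS (a X) (fun i => sq_nonneg _) (ha1 X)
      (by rw [hasum]; exact_mod_cast hX.1)).2 (fun T hT hTS => ?_) ?_
    -- Another optimal vertex `T` would give another real minimizer `v T`; uniqueness forces `v T =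
    -- v S`, and the weights recover `T = S`.
    · have hvT : v T ∈ argmin K {V | Module.finrank ℝ V ≤ R} := by
        have hTS' : K (v T) ≤ K (v S) := by rw [hKle, hJle, hcv, hcv, hTS]
        exact ⟨hvR T hT, fun Y hY => hTS'.trans (hKS.2 hY)⟩
      rw [hV, ← hVS] at hvT
      have hTS' : v T = v S := hvT
      ext i
      have h1 := hav T i
      rw [hTS', hav] at h1
      by_cases h2 : i ∈ S <;> by_cases h3 : i ∈ T
      · exact iff_of_true h3 h2
      · rw [if_pos h2, if_neg h3] at h1
        exact absurd h1 one_ne_zero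
      · rw [if_neg h2, if_pos h3] at h1
        exact absurd h1 zero_ne_one
      · exact iff_of_false h3 h2
    · refine le_antisymm (hle X hX.1) ?_
      rw [← hcv, ← hJle]
      exact hX.2 hJS.1

end IsComplexification

open MeasureTheory Filter Topology
open scoped ENNReal ContDiff


/-! ### The Fourier transform of square integrable functions -/

section Fourier

open FourierTransform Complex

variable {F : Type*} [NormedAddCommGroup F] [InnerProductSpace ℂ F] [CompleteSpace F]

theorem lintegral_enorm_sq_eq {X T : Type*} [NormedAddCommGroup X] [MeasurableSpace T]
    {μ : Measure T} (f : T → X) : ∫⁻ t, ‖f t‖ₑ ^ 2 ∂μ = eLpNorm f 2 μ ^ 2 := by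
  rw [eLpNorm_eq_lintegral_rpow_enorm_toReal two_ne_zero ENNReal.ofNat_ne_top,
    ENNReal.toReal_ofNat, ← ENNReal.rpow_two, ← ENNReal.rpow_mul]
  simp only [one_div, ne_eq, OfNat.ofNat_ne_zero, not_false_eq_true, inv_mul_cancel₀,
    ENNReal.rpow_one, ENNReal.rpow_two]

theorem memLp_two_of_lintegral_enorm_sq {X T : Type*} [NormedAddCommGroup X] [MeasurableSpace T]
    {μ : Measure T} {f : T → X} (hf : AEStronglyMeasurable f μ) (h : ∫⁻ t, ‖f t‖ₑ ^ 2 ∂μ < ⊤) :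
    MemLp f 2 μ := by
  refine ⟨hf, ?_⟩
  rw [lintegral_enorm_sq_eq] at h
  exact (ENNReal.pow_lt_top_iff.mp h).resolve_right two_ne_zero

omit [CompleteSpace F] in
theorem continuous_fourier_of_integrable {f : ℝ → F} (hf : Integrable f) : Continuous (𝓕 f) :=
  VectorFourier.fourierIntegral_continuous Real.continuous_fourierChar
    (by exact continuous_inner) hf

/-- For integrable and square integrable functions, the Fourier transform on `L²` is given by the
Fourier integral. -/
theorem fourier_toLp_ae_eq {f : ℝ → F} (h1 : Integrable f) (h2 : MemLp f 2) :
    (𝓕 (h2.toLp f) : Lp F 2 (volume : Measure ℝ)) =ᵐ[volume] 𝓕 f := by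
  set g : Lp F 2 (volume : Measure ℝ) := 𝓕 (h2.toLp f) with hg
  have hloc1 : LocallyIntegrable g volume :=
    (Lp.memLp g).locallyIntegrable (by norm_num)
  have hloc2 : LocallyIntegrable (𝓕 f) volume :=
    (continuous_fourier_of_integrable h1).locallyIntegrable
  -- Test against smooth compactly supported `φ`. For the `L²` transform, moving `𝓕` onto `φ` is its
  -- compatibility with tempered distributions (`e1`); for the Fourier integral it is the
  -- self-adjointness identity (`e3`).
  have key := ae_eq_zero_of_integral_contDiff_smul_eq_zero (hloc1.sub hloc2) (fun φ hφ hφs => ?_)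
  · filter_upwards [key] with x hx
    exact sub_eq_zero.mp hx
  · have hc : HasCompactSupport fun x => (φ x : ℂ) := hφs.comp_left (g := fun r : ℝ => (r : ℂ)) rfl
    have hd : ContDiff ℝ ∞ fun x => (φ x : ℂ) := Complex.ofRealCLM.contDiff.comp hφ
    set Φ : SchwartzMap ℝ ℂ := hc.toSchwartzMap hd with hΦ
    have hΦx : ∀ x, Φ x = (φ x : ℂ) := fun x => rfl
    have hi1 : Integrable fun x => φ x • g x :=
      hloc1.integrable_smul_left_of_hasCompactSupport hφ.continuous hφs
    have hi2 : Integrable fun x => φ x • 𝓕 f x :=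
      hloc2.integrable_smul_left_of_hasCompactSupport hφ.continuous hφs
    simp only [Pi.sub_apply, smul_sub]
    rw [integral_sub hi1 hi2, sub_eq_zero]
    have e1 := congrArg (fun T : TemperedDistribution ℝ F => T Φ)
      (Lp.fourier_toTemperedDistribution_eq (h2.toLp f))
    simp only [TemperedDistribution.fourier_apply, Lp.toTemperedDistribution_apply] at e1
    have e2 : ∫ x, (𝓕 Φ) x • (h2.toLp f) x = ∫ x, (𝓕 (Φ : ℝ → ℂ)) x • f x := by
      refine integral_congr_ae ?_
      filter_upwards [h2.coeFn_toLp] with x hx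
      rw [hx, SchwartzMap.fourier_coe]
    have e3 : ∫ x, (𝓕 (Φ : ℝ → ℂ)) x • f x = ∫ x, Φ x • 𝓕 f x := by
      have := VectorFourier.integral_fourierIntegral_smul_eq_flip (μ := (volume : Measure ℝ))
        (ν := (volume : Measure ℝ)) (L := innerₗ ℝ) (f := (Φ : ℝ → ℂ)) (g := f)
        Real.continuous_fourierChar (by exact continuous_inner) Φ.integrable h1
      simpa using! this
    rw [e2, e3] at e1
    simp only [hΦx] at e1
    exact e1.symm

theorem lintegral_enorm_sq_fourier_toLp {f : ℝ → F} (h2 : MemLp f 2) :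
    ∫⁻ x, ‖(𝓕 (h2.toLp f) : Lp F 2 (volume : Measure ℝ)) x‖ₑ ^ 2 = ∫⁻ t, ‖f t‖ₑ ^ 2 := by
  rw [lintegral_enorm_sq_eq, lintegral_enorm_sq_eq, ← Lp.enorm_def, ← eLpNorm_congr_ae h2.coeFn_toLp,
    ← Lp.enorm_def, ← ofReal_norm, ← ofReal_norm, Lp.norm_fourier_eq]

/-- Plancherel's theorem. -/
theorem lintegral_enorm_sq_fourier {f : ℝ → F} (h1 : Integrable f) (h2 : MemLp f 2) :
    ∫⁻ x, ‖𝓕 f x‖ₑ ^ 2 = ∫⁻ t, ‖f t‖ₑ ^ 2 := by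
  rw [← lintegral_enorm_sq_fourier_toLp h2]
  refine lintegral_congr_ae ?_
  filter_upwards [fourier_toLp_ae_eq h1 h2] with x hx
  rw [hx]

end Fourier

/-! ### The Poisson kernel of the half plane -/

section Poisson

/-- The Poisson kernel `s ↦ ε / (π (ε² + s²))`. -/
def poissonLine (ε s : ℝ) : ℝ := (Real.pi * ε)⁻¹ * (1 + (s / ε) ^ 2)⁻¹

variable {ε : ℝ}

theorem poissonLine_nonneg (hε : 0 < ε) (s : ℝ) : 0 ≤ poissonLine ε s := by
  unfold poissonLine; positivity

theorem poissonLine_le (hε : 0 < ε) (s : ℝ) : poissonLine ε s ≤ (Real.pi * ε)⁻¹ := by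
  unfold poissonLine
  refine mul_le_of_le_one_right (by positivity) (inv_le_one_of_one_le₀ ?_)
  nlinarith [sq_nonneg (s / ε)]

theorem integrable_poissonLine (hε : 0 < ε) (x : ℝ) :
    Integrable fun y => poissonLine ε (y - x) :=
  ((integrable_inv_one_add_sq.comp_div hε.ne').const_mul _).comp_sub_right x

theorem integral_poissonLine (hε : 0 < ε) (x : ℝ) : ∫ y, poissonLine ε (y - x) = 1 := by
  rw [integral_sub_right_eq_self (poissonLine ε) x]
  unfold poissonLine
  rw [integral_const_mul, Measure.integral_comp_div (fun s => (1 + s ^ 2)⁻¹),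
    integral_univ_inv_one_add_sq, abs_of_pos hε, smul_eq_mul]
  field_simp

variable {F : Type*} [NormedAddCommGroup F] [NormedSpace ℝ F]

/-- The kernel is both integrable and bounded, so `‖h‖ ≤ 1 + ‖h‖²` gives an integrable majorant. -/
theorem integrable_poissonLine_smul (hε : 0 < ε) (x : ℝ) {h : ℝ → F} (hh : MemLp h 2) :
    Integrable fun y => poissonLine ε (y - x) • h y := by
  have hi := (memLp_two_iff_integrable_sq_norm hh.1).mp hh
  refine Integrable.mono' ((integrable_poissonLine hε x).add (hi.const_mul (Real.pi * ε)⁻¹))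
    ((integrable_poissonLine hε x).1.smul hh.1) (Eventually.of_forall fun y => ?_)
  have h0 := poissonLine_nonneg hε (y - x)
  have h1 := poissonLine_le hε (y - x)
  rw [norm_smul, Real.norm_of_nonneg h0, Pi.add_apply]
  calc poissonLine ε (y - x) * ‖h y‖ ≤ poissonLine ε (y - x) * (1 + ‖h y‖ ^ 2) := by
        gcongr
        nlinarith [sq_nonneg (‖h y‖ - 1), norm_nonneg (h y)]
    _ ≤ _ := by
        rw [mul_add, mul_one]
        gcongr

/-- Take the least admissible `k`. For `k ≥ 1` minimality gives `|s| / ε > 2 ^ (k - 1)`, and the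
quadratic decay gives the factor `4 * (1 / 4) ^ k`; for `k = 0` the supremum of the kernel suffices.
-/
theorem exists_poissonLine_le (hε : 0 < ε) (s : ℝ) :
    ∃ k : ℕ, |s| ≤ 2 ^ k * ε ∧ poissonLine ε s ≤ 4 * (1 / 4) ^ k * (Real.pi * ε)⁻¹ := by
  have hex : ∃ k : ℕ, |s| ≤ 2 ^ k * ε := by
    obtain ⟨k, hk⟩ := pow_unbounded_of_one_lt (|s| / ε) (one_lt_two : (1 : ℝ) < 2)
    exact ⟨k, ((div_lt_iff₀ hε).mp hk).le⟩
  classical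
  refine ⟨Nat.find hex, Nat.find_spec hex, ?_⟩
  have hpos : 0 < (Real.pi * ε)⁻¹ := by positivity
  rcases h : Nat.find hex with _ | k
  · have := poissonLine_le hε s
    simp only [pow_zero, mul_one]
    linarith
  · have hlt : 2 ^ k < |s / ε| := by
      have := Nat.find_min hex (m := k) (by omega)
      rw [abs_div, abs_of_pos hε, lt_div_iff₀ hε]
      exact not_le.mp this
    unfold poissonLine
    rw [mul_comm]
    refine mul_le_mul_of_nonneg_right ?_ hpos.le
    have h4 : (4 : ℝ) ^ k ≤ (s / ε) ^ 2 := by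
      rw [← sq_abs, show (4 : ℝ) = 2 ^ 2 by norm_num, ← pow_mul, mul_comm 2 k, pow_mul]
      gcongr
    have : 4 * (1 / 4 : ℝ) ^ (k + 1) = ((4 : ℝ) ^ k)⁻¹ := by
      rw [pow_succ, one_div, inv_pow]; ring
    rw [this]
    exact inv_anti₀ (by positivity) (by linarith)

omit [NormedSpace ℝ F] in
/-- At a Lebesgue point, the averages of a square integrable function are bounded over all radii. -/
theorem exists_setAverage_le {h : ℝ → F} (hh : MemLp h 2) {x : ℝ}
    (hx : Tendsto (fun r => ⨍ y in Metric.closedBall x r, ‖h y - h x‖) (𝓝[>] 0) (𝓝 0)) :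
    ∃ M, ∀ r, 0 < r → ⨍ y in Metric.closedBall x r, ‖h y - h x‖ ≤ M := by
  obtain ⟨δ, hδ, hsmall⟩ : ∃ δ > 0, ∀ r, 0 < r → r < δ →
      ⨍ y in Metric.closedBall x r, ‖h y - h x‖ ≤ 1 := by
    have := hx.eventually (ge_mem_nhds (zero_lt_one' ℝ))
    obtain ⟨δ, hδ, h⟩ := mem_nhdsGT_iff_exists_Ioo_subset.mp this
    exact ⟨δ, hδ, fun r h1 h2 => h ⟨h1, h2⟩⟩
  have hi := (memLp_two_iff_integrable_sq_norm hh.1).mp hh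
  set C := ∫ y, ‖h y‖ ^ 2 with hC
  have hC0 : 0 ≤ C := integral_nonneg fun y => sq_nonneg _
  -- Radii below `δ` have average at most `1` by the Lebesgue point property. For `r ≥ δ`, `‖h y - h
  -- x‖ ≤ 1 + ‖h x‖ + ‖h y‖²` is averaged over an interval of length `2 * r ≥ 2 * δ`.
  refine ⟨1 + ‖h x‖ + C / (2 * δ), fun r hr => ?_⟩
  rcases lt_or_ge r δ with h1 | h1
  · have := hsmall r hr h1
    have h2 : 0 ≤ C / (2 * δ) := by positivity
    linarith [norm_nonneg (h x)]
  · have hvol : (volume.real (Metric.closedBall x r)) = 2 * r := by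
      rw [Measure.real, Real.volume_closedBall, ENNReal.toReal_ofReal (by positivity)]
    have hfin : volume (Metric.closedBall x r) ≠ ⊤ := by
      rw [Real.volume_closedBall]; exact ENNReal.ofReal_ne_top
    have hc : IntegrableOn (fun _ => 1 + ‖h x‖ : ℝ → ℝ) (Metric.closedBall x r) :=
      integrableOn_const hfin
    have hb : ∫ y in Metric.closedBall x r, ‖h y - h x‖ ≤ 2 * r * (1 + ‖h x‖) + C := by
      calc ∫ y in Metric.closedBall x r, ‖h y - h x‖
          ≤ ∫ y in Metric.closedBall x r, ((1 + ‖h x‖) + ‖h y‖ ^ 2) := by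
            refine integral_mono_of_nonneg (Eventually.of_forall fun y => norm_nonneg _)
              (hc.add hi.integrableOn) (Eventually.of_forall fun y => ?_)
            have := norm_sub_le (h y) (h x)
            dsimp only
            nlinarith [sq_nonneg (‖h y‖ - 1), norm_nonneg (h y)]
        _ = 2 * r * (1 + ‖h x‖) + ∫ y in Metric.closedBall x r, ‖h y‖ ^ 2 := by
            rw [integral_add hc hi.integrableOn, setIntegral_const, hvol, smul_eq_mul]
        _ ≤ _ := by
            gcongr
            exact setIntegral_le_integral hi (Eventually.of_forall fun y => sq_nonneg _)
    rw [setAverage_eq, hvol, smul_eq_mul, inv_mul_le_iff₀ (by positivity)]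
    refine hb.trans ?_
    have h2 : C ≤ 2 * r * (C / (2 * δ)) := by
      rw [mul_div_assoc', le_div_iff₀ (by positivity)]
      nlinarith
    linarith

omit [NormedSpace ℝ F] in
-- The kernel is dominated by a sum of multiples of indicators of dyadic balls. The height `4 * (1 /
-- 4) ^ k / (π ε)` times the length `2 * 2 ^ k * ε` is the coefficient `8 / π * (1 / 2) ^ k`. The
-- bound `M` serves only to make the series converge.
theorem lintegral_poissonLine_le (hε : 0 < ε) {h : ℝ → F} (hh : MemLp h 2) (x : ℝ) {M : ℝ}
    (hM : ∀ r, 0 < r → ⨍ y in Metric.closedBall x r, ‖h y - h x‖ ≤ M) :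
    ∫⁻ y, ENNReal.ofReal (poissonLine ε (y - x)) * ‖h y - h x‖ₑ ≤
      ENNReal.ofReal (∑' k : ℕ, 8 / Real.pi * (1 / 2) ^ k *
        ⨍ y in Metric.closedBall x (2 ^ k * ε), ‖h y - h x‖) := by
  set A : ℕ → ℝ := fun k => ⨍ y in Metric.closedBall x (2 ^ k * ε), ‖h y - h x‖ with hA
  have hA0 : ∀ k, 0 ≤ A k := fun k => by
    simp only [hA]
    rw [setAverage_eq]
    exact smul_nonneg (by positivity) (integral_nonneg fun y => norm_nonneg _)
  have hAM : ∀ k, A k ≤ M := fun k => hM _ (by positivity)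
  have hmeas : AEMeasurable (fun y => ‖h y - h x‖ₑ) volume :=
    (hh.1.sub aestronglyMeasurable_const).enorm
  have hloc : ∀ r, IntegrableOn (fun y => ‖h y - h x‖) (Metric.closedBall x r) := fun r =>
    ((((hh.locallyIntegrable (by norm_num)).sub (locallyIntegrable_const (h x))).integrableOn_isCompact
      (isCompact_closedBall x r)).norm)
  have hsum : Summable fun k : ℕ => 8 / Real.pi * (1 / 2) ^ k * A k := by
    refine Summable.of_nonneg_of_le (fun k => mul_nonneg (by positivity) (hA0 k))
      (fun k => mul_le_mul_of_nonneg_left (hAM k) (by positivity)) ?_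
    exact (summable_geometric_two.mul_left _).mul_right M
  rw [ENNReal.ofReal_tsum_of_nonneg (fun k => mul_nonneg (by positivity) (hA0 k)) hsum]
  have hterm : ∀ k : ℕ, ENNReal.ofReal (8 / Real.pi * (1 / 2) ^ k * A k) =
      ∫⁻ y, (Metric.closedBall x (2 ^ k * ε)).indicator
        (fun y => ENNReal.ofReal (4 * (1 / 4) ^ k * (Real.pi * ε)⁻¹) * ‖h y - h x‖ₑ) y := by
    intro k
    rw [lintegral_indicator measurableSet_closedBall, lintegral_const_mul'' _ hmeas.restrict]
    have h1 : ∫⁻ y in Metric.closedBall x (2 ^ k * ε), ‖h y - h x‖ₑ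
        = ENNReal.ofReal (2 * (2 ^ k * ε) * A k) := by
      simp only [← ofReal_norm]
      rw [← ofReal_integral_eq_lintegral_ofReal (hloc _) (Eventually.of_forall fun y => norm_nonneg _)]
      congr 1
      simp only [hA]
      rw [setAverage_eq, Measure.real, Real.volume_closedBall,
        ENNReal.toReal_ofReal (by positivity), smul_eq_mul, mul_inv_cancel_left₀ (by positivity)]
    rw [h1, ← ENNReal.ofReal_mul (by positivity)]
    congr 1
    have h2 : (1 / 4 : ℝ) ^ k * 2 ^ k = (1 / 2) ^ k := by rw [← mul_pow]; norm_num
    rw [← h2]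
    field_simp
    ring
  simp only [hterm]
  rw [← lintegral_tsum fun k => (hmeas.const_mul _).indicator measurableSet_closedBall]
  refine lintegral_mono fun y => ?_
  obtain ⟨k, hk1, hk2⟩ := exists_poissonLine_le hε (y - x)
  refine le_trans ?_ (ENNReal.le_tsum k)
  rw [Set.indicator_of_mem (by rwa [Metric.mem_closedBall, Real.dist_eq])]
  gcongr

/-- The Poisson integrals of a square integrable function converge almost everywhere. -/
theorem ae_tendsto_integral_poissonLine [CompleteSpace F] {h : ℝ → F} (hh : MemLp h 2) :
    ∀ᵐ x, Tendsto (fun ε => ∫ y, poissonLine ε (y - x) • h y) (𝓝[>] 0) (𝓝 (h x)) := by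
  have hloc : LocallyIntegrable h volume := hh.locallyIntegrable (by norm_num)
  filter_upwards [IsUnifLocDoublingMeasure.ae_tendsto_average_norm_sub volume hloc 1] with x hx
  have hA : Tendsto (fun r => ⨍ y in Metric.closedBall x r, ‖h y - h x‖) (𝓝[>] 0) (𝓝 0) :=
    hx (fun _ => x) id tendsto_id (by
      filter_upwards [self_mem_nhdsWithin] with r hr
      simpa using (le_of_lt hr : (0 : ℝ) ≤ r))
  obtain ⟨M, hM⟩ := exists_setAverage_le hh hA
  have hA0 : ∀ r, 0 ≤ ⨍ y in Metric.closedBall x r, ‖h y - h x‖ := fun r => by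
    rw [setAverage_eq]
    exact smul_nonneg (by positivity) (integral_nonneg fun y => norm_nonneg _)
  -- For fixed `k` the average tends to zero since `x` is a Lebesgue point; the bound `M` over all
  -- radii supplies a geometric majorant, so the limit passes through the sum.
  have htannery : Tendsto (fun ε => ∑' k : ℕ, 8 / Real.pi * (1 / 2) ^ k *
      ⨍ y in Metric.closedBall x (2 ^ k * ε), ‖h y - h x‖) (𝓝[>] 0) (𝓝 0) := by
    have hb : Summable fun k : ℕ => 8 / Real.pi * (1 / 2) ^ k * M :=
      (summable_geometric_two.mul_left _).mul_right M
    have := tendsto_tsum_of_dominated_convergence (𝓕 := 𝓝[>] (0 : ℝ)) (f := fun ε (k : ℕ) =>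
      8 / Real.pi * (1 / 2) ^ k * ⨍ y in Metric.closedBall x (2 ^ k * ε), ‖h y - h x‖)
      (g := fun _ => (0 : ℝ)) hb (fun k => ?_) ?_
    · simpa using this
    · have h1 : Tendsto (fun ε : ℝ => 2 ^ k * ε) (𝓝[>] 0) (𝓝[>] 0) := by
        refine tendsto_nhdsWithin_iff.mpr ⟨?_, ?_⟩
        · have : Tendsto (fun ε : ℝ => 2 ^ k * ε) (𝓝 0) (𝓝 (2 ^ k * 0)) :=
            tendsto_id.const_mul _
          rw [mul_zero] at this
          exact this.mono_left nhdsWithin_le_nhds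
        · filter_upwards [self_mem_nhdsWithin] with ε hε
          exact mul_pos (pow_pos two_pos k) (Set.mem_Ioi.mp hε)
      have := (hA.comp h1).const_mul (8 / Real.pi * (1 / 2) ^ k)
      rwa [mul_zero] at this
    · filter_upwards [self_mem_nhdsWithin] with ε hε k
      have hε' : (0 : ℝ) < ε := hε
      rw [Real.norm_of_nonneg (mul_nonneg (by positivity) (hA0 _))]
      exact mul_le_mul_of_nonneg_left (hM _ (by positivity)) (by positivity)
  rw [tendsto_iff_norm_sub_tendsto_zero]
  refine squeeze_zero' (Eventually.of_forall fun ε => norm_nonneg _) ?_ htannery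
  filter_upwards [self_mem_nhdsWithin] with ε hε
  have hε' : (0 : ℝ) < ε := hε
  have h0 : 0 ≤ ∑' k : ℕ, 8 / Real.pi * (1 / 2) ^ k *
      ⨍ y in Metric.closedBall x (2 ^ k * ε), ‖h y - h x‖ :=
    tsum_nonneg fun k => mul_nonneg (by positivity) (hA0 _)
  have hconst : Integrable fun y => poissonLine ε (y - x) • h x :=
    (integrable_poissonLine hε' x).smul_const _
  -- The kernel has mass one.
  have e : (∫ y, poissonLine ε (y - x) • h y) - h x
      = ∫ y, poissonLine ε (y - x) • (h y - h x) := by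
    simp only [smul_sub]
    rw [integral_sub (integrable_poissonLine_smul hε' x hh) hconst, integral_smul_const,
      integral_poissonLine hε', one_smul]
  rw [e, ← ENNReal.ofReal_le_ofReal_iff h0, ofReal_norm]
  refine (enorm_integral_le_lintegral_enorm _).trans
    (le_trans (le_of_eq ?_) (lintegral_poissonLine_le hε' hh x hM))
  refine lintegral_congr fun y => ?_
  rw [enorm_smul, ← ofReal_norm, Real.norm_of_nonneg (poissonLine_nonneg hε' _)]

end Poisson

open MeasureTheory Filter Topology
open scoped ENNReal ContDiff


/-! ### Abel means of Fourier integrals -/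

section AbelFourier

open FourierTransform Complex

theorem lintegral_comp_const_mul (f : ℝ → ℝ≥0∞) {a : ℝ} (ha : a ≠ 0) :
    ∫⁻ x, f (a * x) = ENNReal.ofReal |a⁻¹| * ∫⁻ x, f x := by
  have h := (Homeomorph.mulLeft₀ a ha).measurableEmbedding.lintegral_map (μ := volume) f
  simp only [Homeomorph.coe_mulLeft₀] at h
  rw [← h, Real.map_volume_mul_left ha, lintegral_smul_measure, smul_eq_mul]

theorem ae_comp_const_mul {p : ℝ → Prop} (h : ∀ᵐ x, p x) {a : ℝ} (ha : a ≠ 0) :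
    ∀ᵐ x, p (a * x) := by
  have hq : Measure.QuasiMeasurePreserving (fun x : ℝ => a * x) volume volume := by
    refine ⟨measurable_const_mul a, ?_⟩
    rw [Real.map_volume_mul_left ha]
    exact Measure.smul_absolutelyContinuous
  exact hq.ae h

variable {ε : ℝ}

theorem integrable_exp_neg_mul_abs (hε : 0 < ε) : Integrable fun t : ℝ => Real.exp (-(ε * |t|)) := by
  have h1 : IntegrableOn (fun t : ℝ => Real.exp (-(ε * |t|))) (Set.Iic 0) := by
    refine (integrableOn_exp_mul_Iic hε 0).congr_fun (fun t ht => ?_) measurableSet_Iic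
    simp only [abs_of_nonpos (Set.mem_Iic.mp ht), mul_neg, neg_neg]
  have h2 : IntegrableOn (fun t : ℝ => Real.exp (-(ε * |t|))) (Set.Ioi 0) := by
    refine (integrableOn_exp_mul_Ioi (neg_lt_zero.mpr hε) 0).congr_fun (fun t ht => ?_)
      measurableSet_Ioi
    simp only [abs_of_pos (Set.mem_Ioi.mp ht), neg_mul]
  have h := h1.union h2
  rwa [Set.Iic_union_Ioi, integrableOn_univ] at h

theorem memLp_exp_neg_mul_abs (hε : 0 < ε) : MemLp (fun t : ℝ => Real.exp (-(ε * |t|))) 2 := by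
  refine (memLp_two_iff_integrable_sq_norm (by fun_prop)).mpr ?_
  refine (integrable_exp_neg_mul_abs (mul_pos two_pos hε)).congr (Eventually.of_forall fun t => ?_)
  simp only [Real.norm_eq_abs, sq_abs, ← Real.exp_nat_mul]
  congr 1
  push_cast
  ring

/-- The two half lines contribute `1 / (ε + ib)` and `1 / (ε - ib)`. Up to scaling, the sum is the
Poisson kernel. -/
theorem integral_exp_neg_mul_abs (hε : 0 < ε) (b : ℝ) :
    ∫ t : ℝ, cexp (-((ε * |t| : ℝ) : ℂ) + I * b * t) = (2 / ε * (1 + (b / ε) ^ 2)⁻¹ : ℝ) := by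
  have hint : Integrable fun t : ℝ => cexp (-((ε * |t| : ℝ) : ℂ) + I * b * t) := by
    refine (integrable_exp_neg_mul_abs hε).mono' (by fun_prop) (Eventually.of_forall fun t => ?_)
    rw [Complex.norm_exp]
    simp
  rw [← setIntegral_univ, ← Set.Iic_union_Ioi (a := (0 : ℝ)),
    setIntegral_union (Set.Iic_disjoint_Ioi le_rfl) measurableSet_Ioi hint.integrableOn
      hint.integrableOn]
  have h1 : ∫ t in Set.Iic (0 : ℝ), cexp (-((ε * |t| : ℝ) : ℂ) + I * b * t)
      = ∫ t in Set.Iic (0 : ℝ), cexp ((ε + I * b) * t) := by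
    refine setIntegral_congr_fun measurableSet_Iic fun t ht => ?_
    simp only [abs_of_nonpos (Set.mem_Iic.mp ht)]
    congr 1
    push_cast
    ring
  have h2 : ∫ t in Set.Ioi (0 : ℝ), cexp (-((ε * |t| : ℝ) : ℂ) + I * b * t)
      = ∫ t in Set.Ioi (0 : ℝ), cexp ((-ε + I * b) * t) := by
    refine setIntegral_congr_fun measurableSet_Ioi fun t ht => ?_
    simp only [abs_of_pos (Set.mem_Ioi.mp ht)]
    congr 1
    push_cast
    ring
  rw [h1, h2, integral_exp_mul_complex_Iic (by simpa using hε),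
    integral_exp_mul_complex_Ioi (by simpa using hε)]
  have n1 : (ε + I * b : ℂ) ≠ 0 := fun h => hε.ne' (by simpa using congrArg Complex.re h)
  have n2 : (-ε + I * b : ℂ) ≠ 0 := fun h => hε.ne' (by simpa using congrArg Complex.re h)
  have n3 : (ε : ℂ) ≠ 0 := by exact_mod_cast hε.ne'
  have n4 : (1 + (b / ε) ^ 2 : ℂ) ≠ 0 := by
    have : (1 + (b / ε) ^ 2 : ℝ) ≠ 0 := by positivity
    exact_mod_cast this
  have n5 : (ε ^ 2 + b ^ 2 : ℂ) ≠ 0 := by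
    have : (ε ^ 2 + b ^ 2 : ℝ) ≠ 0 := by positivity
    exact_mod_cast this
  push_cast
  have e : (1 + (b / ε : ℂ) ^ 2)⁻¹ = (ε : ℂ) ^ 2 / ((ε : ℂ) ^ 2 + (b : ℂ) ^ 2) := by
    rw [inv_eq_one_div, div_eq_div_iff n4 n5]
    field_simp
  rw [e, mul_zero, Complex.exp_zero, mul_zero, Complex.exp_zero, div_add_div _ _ n1 n2, ← mul_div_assoc, div_eq_div_iff (mul_ne_zero n1 n2) n5]
  field_simp
  linear_combination (-2 * ε * b ^ 2 : ℂ) * I_sq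

variable {F : Type*} [NormedAddCommGroup F] [InnerProductSpace ℂ F]

/-- The Abel mean `∫ e^{-ε|t|} e^{-iτt} G(t) dt` of the Fourier integral of `G`. -/
def abelFourier (ε : ℝ) (G : ℝ → F) (τ : ℝ) : F :=
  ∫ t : ℝ, cexp (-((ε * |t| : ℝ) : ℂ) - I * τ * t) • G t

/-- `𝓕` carries `2π` in its exponent, so `τ` becomes the frequency `τ / 2π`; this is the source of
the factor `2π` in Plancherel's identity below. -/
theorem abelFourier_eq_fourier (ε : ℝ) (G : ℝ → F) (τ : ℝ) :
    abelFourier ε G τ = 𝓕 (fun t : ℝ => Real.exp (-(ε * |t|)) • G t) ((2 * Real.pi)⁻¹ * τ) := by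
  rw [Real.fourier_real_eq_integral_exp_smul, abelFourier]
  refine integral_congr_ae (Eventually.of_forall fun t => ?_)
  have hs : Real.exp (-(ε * |t|)) • G t = cexp (-((ε * |t| : ℝ) : ℂ)) • G t := by
    rw [← Complex.ofReal_neg, ← Complex.ofReal_exp]
    rfl
  have hp : (Real.pi : ℂ) ≠ 0 := by exact_mod_cast Real.pi_ne_zero
  simp only [hs, smul_smul, ← Complex.exp_add]
  congr 2
  push_cast
  field_simp
  ring

theorem integrable_exp_smul (hε : 0 < ε) {G : ℝ → F} (hG : MemLp G 2) :
    Integrable fun t : ℝ => Real.exp (-(ε * |t|)) • G t := by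
  have h : MemLp ((fun t : ℝ => Real.exp (-(ε * |t|))) • G) 1 :=
    MemLp.smul (𝕜 := ℝ) hG (memLp_exp_neg_mul_abs hε)
  exact memLp_one_iff_integrable.mp h

theorem memLp_exp_smul (hε : 0 ≤ ε) {G : ℝ → F} (hG : MemLp G 2) :
    MemLp (fun t : ℝ => Real.exp (-(ε * |t|)) • G t) 2 := by
  refine hG.mono ((by fun_prop : AEStronglyMeasurable (fun t : ℝ => Real.exp (-(ε * |t|)))
    volume).smul hG.1) (Eventually.of_forall fun t => ?_)
  rw [norm_smul, Real.norm_of_nonneg (Real.exp_nonneg _)]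
  refine mul_le_of_le_one_left (norm_nonneg _) (Real.exp_le_one_iff.mpr ?_)
  have := mul_nonneg hε (abs_nonneg t)
  linarith

theorem integrable_abelFourier (hε : 0 < ε) (τ : ℝ) {G : ℝ → F} (hG : MemLp G 2) :
    Integrable fun t : ℝ => cexp (-((ε * |t| : ℝ) : ℂ) - I * τ * t) • G t := by
  refine (integrable_exp_smul hε hG).mono ((by fun_prop : AEStronglyMeasurable (fun t : ℝ =>
    cexp (-((ε * |t| : ℝ) : ℂ) - I * τ * t)) volume).smul hG.1) (Eventually.of_forall fun t => ?_)
  rw [norm_smul, norm_smul, Complex.norm_exp, Real.norm_of_nonneg (Real.exp_nonneg _)]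
  simp

variable [CompleteSpace F]

theorem lintegral_enorm_sq_abelFourier (hε : 0 < ε) {G : ℝ → F} (hG : MemLp G 2) :
    ∫⁻ τ, ‖abelFourier ε G τ‖ₑ ^ 2
      = ENNReal.ofReal (2 * Real.pi) * ∫⁻ t, ‖Real.exp (-(ε * |t|)) • G t‖ₑ ^ 2 := by
  simp only [abelFourier_eq_fourier]
  rw [lintegral_comp_const_mul (fun x => ‖𝓕 (fun t : ℝ => Real.exp (-(ε * |t|)) • G t) x‖ₑ ^ 2)
    (by positivity), lintegral_enorm_sq_fourier (integrable_exp_smul hε hG)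
    (memLp_exp_smul hε.le hG), inv_inv, abs_of_pos (by positivity)]

/-- The Abel means are the Poisson integrals of the Fourier transform. -/
theorem abelFourier_eq_integral_poissonLine (hε : 0 < ε) {G : ℝ → F} (hG : MemLp G 2) (x : ℝ) :
    abelFourier ε G (2 * Real.pi * x) = ∫ y, poissonLine ((2 * Real.pi)⁻¹ * ε) (y - x) •
      (𝓕 (hG.toLp G) : Lp F 2 (volume : Measure ℝ)) y := by
  refine ext_inner_left ℂ fun w => ?_
  -- Pairing `ψ` with `G` gives the Abel mean tested against `w`: the plus sign is undone by
  -- conjugation in the first slot. Since `𝓕 ψ` is the Poisson kernel times `w`, Parseval gives the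
  -- claim.
  set ψ : ℝ → F := fun t => cexp (-((ε * |t| : ℝ) : ℂ) + I * (2 * Real.pi * x : ℝ) * t) • w with hψ
  have hnorm : ∀ t, ‖ψ t‖ = ‖Real.exp (-(ε * |t|)) • w‖ := fun t => by
    rw [hψ, norm_smul, norm_smul, Complex.norm_exp, Real.norm_of_nonneg (Real.exp_nonneg _)]
    simp
  have hmeas : AEStronglyMeasurable ψ volume := by
    refine Continuous.aestronglyMeasurable ?_
    fun_prop
  have h1 : Integrable ψ :=
    ((integrable_exp_neg_mul_abs hε).smul_const w).mono hmeas
      (Eventually.of_forall fun t => (hnorm t).le)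
  have h2 : MemLp ψ 2 :=
    (memLp_exp_neg_mul_abs hε).of_le_mul (c := ‖w‖) hmeas
      (Eventually.of_forall fun t => by rw [hnorm, norm_smul, mul_comm])
  have hδ : 0 < (2 * Real.pi)⁻¹ * ε := by positivity
  have hF : ∀ y, 𝓕 ψ y = (poissonLine ((2 * Real.pi)⁻¹ * ε) (y - x) : ℂ) • w := by
    intro y
    rw [Real.fourier_real_eq_integral_exp_smul]
    have e : ∀ t : ℝ, cexp (↑(-2 * Real.pi * t * y) * I) • ψ t
        = cexp (-((ε * |t| : ℝ) : ℂ) + I * (2 * Real.pi * (x - y) : ℝ) * t) • w := fun t => by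
      simp only [hψ, smul_smul, ← Complex.exp_add]
      congr 2
      push_cast
      ring
    simp only [e]
    rw [integral_smul_const, integral_exp_neg_mul_abs hε]
    congr 2
    unfold poissonLine
    have hp := Real.pi_pos
    have e2 : ((y - x) / ((2 * Real.pi)⁻¹ * ε)) ^ 2 = (2 * Real.pi * (x - y) / ε) ^ 2 := by
      rw [div_pow, div_pow]
      field_simp
      ring
    rw [e2]
    congr 1
    field_simp
  have hpl := Lp.inner_fourier_eq (h2.toLp ψ) (hG.toLp G)
  rw [L2.inner_def, L2.inner_def] at hpl
  have hL : ∫ t, inner ℂ (h2.toLp ψ t) (hG.toLp G t) = inner ℂ w (abelFourier ε G (2 * Real.pi * x)) := by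
    rw [abelFourier, ← integral_inner (integrable_abelFourier hε _ hG)]
    refine integral_congr_ae ?_
    filter_upwards [h2.coeFn_toLp, hG.coeFn_toLp] with t ht ht'
    rw [ht, ht', hψ, inner_smul_left, inner_smul_right, ← Complex.exp_conj]
    congr 2
    simp only [map_add, map_neg, map_mul, Complex.conj_ofReal, Complex.conj_I]
    push_cast
    ring
  have hR : ∫ y, inner ℂ ((𝓕 (h2.toLp ψ) : Lp F 2 (volume : Measure ℝ)) y)
        ((𝓕 (hG.toLp G) : Lp F 2 (volume : Measure ℝ)) y)
      = inner ℂ w (∫ y, poissonLine ((2 * Real.pi)⁻¹ * ε) (y - x) •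
          (𝓕 (hG.toLp G) : Lp F 2 (volume : Measure ℝ)) y) := by
    rw [← integral_inner (integrable_poissonLine_smul hδ x (Lp.memLp _))]
    refine integral_congr_ae ?_
    filter_upwards [fourier_toLp_ae_eq h1 h2] with y hy
    rw [hy, hF, inner_smul_left, Complex.conj_ofReal, RCLike.real_smul_eq_coe_smul (K := ℂ), inner_smul_right]
    rfl
  rw [← hL, ← hR, hpl]

/-- The Abel means of the Fourier integral of a square integrable function converge almost
everywhere, and the limit satisfies Plancherel's identity. -/
theorem exists_ae_tendsto_abelFourier {G : ℝ → F} (hG : MemLp G 2) :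
    ∃ Φ : ℝ → F, (∀ᵐ τ, Tendsto (fun ε => abelFourier ε G τ) (𝓝[>] 0) (𝓝 (Φ τ))) ∧
      ∫⁻ τ, ‖Φ τ‖ₑ ^ 2 = ENNReal.ofReal (2 * Real.pi) * ∫⁻ t, ‖G t‖ₑ ^ 2 := by
  set g : Lp F 2 (volume : Measure ℝ) := 𝓕 (hG.toLp G) with hg
  refine ⟨fun τ => g ((2 * Real.pi)⁻¹ * τ), ?_, ?_⟩
  · have hp : (2 * Real.pi)⁻¹ ≠ 0 := by positivity
    filter_upwards [ae_comp_const_mul (ae_tendsto_integral_poissonLine (Lp.memLp g)) hp] with τ hτ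
    have hscale : Tendsto (fun ε : ℝ => (2 * Real.pi)⁻¹ * ε) (𝓝[>] 0) (𝓝[>] 0) := by
      refine tendsto_nhdsWithin_iff.mpr ⟨?_, ?_⟩
      · have : Tendsto (fun ε : ℝ => (2 * Real.pi)⁻¹ * ε) (𝓝 0) (𝓝 ((2 * Real.pi)⁻¹ * 0)) :=
          tendsto_id.const_mul _
        rw [mul_zero] at this
        exact this.mono_left nhdsWithin_le_nhds
      · filter_upwards [self_mem_nhdsWithin] with ε hε
        exact mul_pos (by positivity : (0 : ℝ) < (2 * Real.pi)⁻¹) (Set.mem_Ioi.mp hε)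
    refine (hτ.comp hscale).congr' ?_
    filter_upwards [self_mem_nhdsWithin] with ε hε
    have h := abelFourier_eq_integral_poissonLine (Set.mem_Ioi.mp hε) hG ((2 * Real.pi)⁻¹ * τ)
    rw [mul_inv_cancel_left₀ (by positivity)] at h
    exact h.symm
  · rw [lintegral_comp_const_mul (fun x => ‖g x‖ₑ ^ 2) (by positivity), inv_inv,
      abs_of_pos (by positivity), hg, lintegral_enorm_sq_fourier_toLp]

end AbelFourier

open MeasureTheory Filter Topology
open scoped ENNReal ContDiff


/-! ### The Laplace transform and the Hardy norm -/

section LaplaceHardy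

open Complex

theorem tendsto_sub_const_nhdsGT (α : ℝ) : Tendsto (fun σ => σ - α) (𝓝[>] α) (𝓝[>] 0) := by
  refine tendsto_nhdsWithin_iff.mpr ⟨?_, ?_⟩
  · have : Tendsto (fun σ : ℝ => σ - α) (𝓝 α) (𝓝 (α - α)) := tendsto_id.sub_const _
    rw [sub_self] at this
    exact this.mono_left nhdsWithin_le_nhds
  · filter_upwards [self_mem_nhdsWithin] with σ hσ
    exact sub_pos.mpr (Set.mem_Ioi.mp hσ)

/-- The function `e^{-αt} f(t)` on `t > 0`, extended by zero. -/
def weighted {X : Type*} [NormedAddCommGroup X] [NormedSpace ℝ X] (α : ℝ) (f : ℝ → X) : ℝ → X :=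
  (Set.Ioi (0 : ℝ)).indicator fun t => Real.exp (-(α * t)) • f t

theorem memLp_weighted {X : Type} [NormedAddCommGroup X] [NormedSpace ℝ X] {α : ℝ} {f : ℝ → X}
    (hf : MemWeightedL2 α f) : MemLp (weighted α f) 2 := by
  refine (memLp_indicator_iff_restrict measurableSet_Ioi).mpr
    (memLp_two_of_lintegral_enorm_sq ?_ ?_)
  · exact (by fun_prop : Measurable fun t : ℝ =>
      Real.exp (-(α * t))).aestronglyMeasurable.smul hf.1
  · refine lt_of_eq_of_lt (lintegral_congr fun t => ?_) hf.2
    rw [enorm_smul, mul_pow, mul_comm, ← ofReal_norm (Real.exp _),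
      Real.norm_of_nonneg (Real.exp_nonneg _), ← ENNReal.ofReal_pow (Real.exp_nonneg _),
      ← Real.exp_nat_mul]
    congr 3
    push_cast
    ring

variable {E : Type} [NormedAddCommGroup E] [InnerProductSpace ℂ E]

/-- The factor `e^{-st}` splits into the weight `e^{-αt}`, the Abel factor `e^{-εt}` and an
oscillation. Approaching the boundary line thus means `ε → 0+` with one fixed square integrable
function. -/
theorem laplaceTransform_linePoint (α ε τ : ℝ) (f : ℝ → E) :
    laplaceTransform f (linePoint (α + ε) τ) = abelFourier ε (weighted α f) τ := by
  rw [laplaceTransform, abelFourier, ← integral_indicator measurableSet_Ioi]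
  refine integral_congr_ae (Eventually.of_forall fun t => ?_)
  by_cases ht : t ∈ Set.Ioi (0 : ℝ)
  · have hs : ∀ x : E, Real.exp (-(α * t)) • x = cexp (-((α * t : ℝ) : ℂ)) • x := fun x => by
      rw [← Complex.ofReal_neg, ← Complex.ofReal_exp]
      rfl
    simp only [weighted, Set.indicator_of_mem ht, hs, smul_smul, ← Complex.exp_add,
      abs_of_pos (Set.mem_Ioi.mp ht), linePoint]
    congr 2
    push_cast
    ring
  · simp only [weighted, Set.indicator_of_notMem ht, smul_zero]

theorem differentiableOn_laplaceTransform {α : ℝ} {f : ℝ → E} (hf : MemWeightedL2 α f) :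
    DifferentiableOn ℂ (laplaceTransform f) {s | α < s.re} := by
  intro s hs
  rw [Set.mem_ofPred_eq] at hs
  -- Half the distance to the boundary line: on the ball of radius `δ` the integrand still decays
  -- like `e^{-δt}` relative to the weighted function, and half of this decay absorbs the factor `t`
  -- of the derivative.
  set δ := (s.re - α) / 2 with hδ
  have hδ0 : 0 < δ := by rw [hδ]; linarith
  have hG := memLp_weighted hf
  have hnorm : ∀ z : ℂ, ∀ t ∈ Set.Ioi (0 : ℝ), ∀ η : ℝ, α + η ≤ z.re →
      ‖cexp (-z * t) • f t‖ ≤ ‖Real.exp (-(η * |t|)) • weighted α f t‖ := by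
    intro z t ht η hz
    rw [weighted, Set.indicator_of_mem ht, smul_smul, ← Real.exp_add, norm_smul, norm_smul,
      Complex.norm_exp, Real.norm_of_nonneg (Real.exp_nonneg _), abs_of_pos (Set.mem_Ioi.mp ht)]
    refine mul_le_mul_of_nonneg_right (Real.exp_le_exp.mpr ?_) (norm_nonneg _)
    have ht' : 0 < t := ht
    simp only [mul_re, neg_re, ofReal_re, neg_im, ofReal_im, mul_zero, sub_zero]
    nlinarith
  have hmeas : ∀ z : ℂ, AEStronglyMeasurable (fun t : ℝ => cexp (-z * t) • f t)
      (volume.restrict (Set.Ioi 0)) := fun z =>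
    (by fun_prop : Measurable fun t : ℝ => cexp (-z * t)).aestronglyMeasurable.smul hf.1
  have hint : Integrable (fun t : ℝ => cexp (-s * t) • f t) (volume.restrict (Set.Ioi 0)) := by
    refine ((integrable_exp_smul hδ0 hG).integrableOn (s := Set.Ioi 0)).norm.mono' (hmeas s) ?_
    filter_upwards [ae_restrict_mem measurableSet_Ioi] with t ht
    exact hnorm s t ht δ (by rw [hδ]; linarith)
  have hball : ∀ z ∈ Metric.ball s δ, α + δ ≤ z.re := by
    intro z hz
    have h1 : |(z - s).re| < δ := (abs_re_le_norm _).trans_lt (mem_ball_iff_norm.mp hz)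
    rw [sub_re] at h1
    have := (abs_lt.mp h1).1
    have h2 : s.re = α + 2 * δ := by rw [hδ]; ring
    linarith
  have key := hasDerivAt_integral_of_dominated_loc_of_deriv_le
    (μ := volume.restrict (Set.Ioi (0 : ℝ))) (F := fun (z : ℂ) (t : ℝ) => cexp (-z * t) • f t)
    (F' := fun z t => (-(t : ℂ)) • cexp (-z * t) • f t)
    (bound := fun t => 2 / δ * ‖Real.exp (-(δ / 2 * |t|)) • weighted α f t‖)
    (Metric.ball_mem_nhds s hδ0) (Eventually.of_forall hmeas) hint
    ((by fun_prop : Measurable fun t : ℝ => -(t : ℂ)).aestronglyMeasurable.smul (hmeas s)) ?_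
    (((integrable_exp_smul (half_pos hδ0) hG).integrableOn).norm.const_mul _) ?_
  · exact key.2.differentiableAt.differentiableWithinAt
  · filter_upwards [ae_restrict_mem measurableSet_Ioi] with t ht z hz
    have ht' : 0 < t := ht
    have h1 := hnorm z t ht δ (hball z hz)
    have h2 : t ≤ 2 / δ * Real.exp (δ / 2 * t) := by
      have := Real.add_one_le_exp (δ / 2 * t)
      have h3 : t = 2 / δ * (δ / 2 * t) := by field_simp
      calc t = 2 / δ * (δ / 2 * t) := h3
        _ ≤ _ := by gcongr; linarith
    rw [norm_smul, norm_neg, Complex.norm_real, Real.norm_of_nonneg ht'.le]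
    refine (mul_le_mul h2 h1 (norm_nonneg _) (by positivity)).trans (le_of_eq ?_)
    rw [norm_smul, norm_smul, Real.norm_of_nonneg (Real.exp_nonneg _),
      Real.norm_of_nonneg (Real.exp_nonneg _), abs_of_pos ht', mul_assoc, ← mul_assoc (Real.exp _),
      ← Real.exp_add]
    congr 3
    ring
  · refine Eventually.of_forall fun t z _ => ?_
    have h1 : HasDerivAt (fun z : ℂ => -z * t) (-(t : ℂ)) z := by
      simpa using (hasDerivAt_id z).neg.mul_const (t : ℂ)
    have h2 := (h1.cexp).smul_const (f t)
    rw [smul_smul, mul_comm]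
    exact h2

/-- The Hardy norm of a function given on vertical lines by the Fourier integrals of
`e^{-ε|t|} G(t)`. -/
theorem hardyNorm_sq_eq [CompleteSpace E] {α : ℝ} {K : ℂ → E} {G : ℝ → E} (hG : MemLp G 2)
    (hK : ∀ ε, 0 < ε → ∀ τ, K (linePoint (α + ε) τ) = abelFourier ε G τ) :
    hardyNorm α K ^ 2 = ∫⁻ t, ‖G t‖ₑ ^ 2 := by
  have hpi : ENNReal.ofReal (2 * Real.pi) ≠ 0 := by
    rw [ne_eq, ENNReal.ofReal_eq_zero, not_le]; positivity
  have hline : ∀ ε, 0 < ε →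
      ∫⁻ τ : ℝ, ‖K (linePoint (α + ε) τ)‖ₑ ^ 2 / ENNReal.ofReal (2 * Real.pi)
        = ∫⁻ t, ‖Real.exp (-(ε * |t|)) • G t‖ₑ ^ 2 := by
    intro ε hε
    simp only [hK ε hε, div_eq_mul_inv]
    rw [lintegral_mul_const' _ _ (ENNReal.inv_ne_top.mpr hpi), lintegral_enorm_sq_abelFourier hε hG,
      mul_comm, ← mul_assoc, ENNReal.inv_mul_cancel hpi ENNReal.ofReal_ne_top, one_mul]
  have hmono : ∀ ε η t, ε ≤ η →
      ‖Real.exp (-(η * |t|)) • G t‖ₑ ^ 2 ≤ ‖Real.exp (-(ε * |t|)) • G t‖ₑ ^ 2 := by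
    intro ε η t h
    gcongr
    rw [enorm_smul, enorm_smul, ← ofReal_norm, ← ofReal_norm (Real.exp (-(ε * |t|))),
      Real.norm_of_nonneg (Real.exp_nonneg _), Real.norm_of_nonneg (Real.exp_nonneg _)]
    gcongr
  have hsup : hardyNorm α K = (∫⁻ t, ‖G t‖ₑ ^ 2) ^ (1 / 2 : ℝ) := by
    refine le_antisymm (iSup₂_le fun σ hσ => ?_) ?_
    · have h := hline (σ - α) (sub_pos.mpr hσ)
      rw [add_sub_cancel] at h
      rw [h]
      refine ENNReal.rpow_le_rpow (lintegral_mono fun t => ?_) (by norm_num)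
      simpa using hmono 0 (σ - α) t (sub_pos.mpr hσ).le
    -- The line integrals increase as `ε` decreases, so monotone convergence along this sequence
    -- reaches the full integral of `‖G‖²`.
    · set ε : ℕ → ℝ := fun n => 1 / ((n : ℝ) + 1) with hε
      have hε0 : ∀ n, 0 < ε n := fun n => by simp only [hε]; positivity
      have hlim : Tendsto (fun n => ∫⁻ t, ‖Real.exp (-(ε n * |t|)) • G t‖ₑ ^ 2) atTop
          (𝓝 (∫⁻ t, ‖G t‖ₑ ^ 2)) := by
        refine lintegral_tendsto_of_tendsto_of_monotone
          (fun n => (memLp_exp_smul (hε0 n).le hG).1.enorm.pow_const 2)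
          (Eventually.of_forall fun t m n hmn => ?_) (Eventually.of_forall fun t => ?_)
        · exact hmono _ _ t (one_div_le_one_div_of_le (by positivity) (by gcongr))
        · have h1 : Tendsto (fun n => Real.exp (-(ε n * |t|)) • G t) atTop (𝓝 (G t)) := by
            have h2 : Tendsto ε atTop (𝓝 0) := tendsto_one_div_add_atTop_nhds_zero_nat
            have h3 := ((Real.continuous_exp.tendsto _).comp (h2.mul_const |t|).neg).smul_const (G t)
            simpa using h3
          exact ((ENNReal.continuous_pow 2).tendsto _).comp h1.enorm
      have hlim' := ((ENNReal.continuous_rpow_const (y := (1 / 2 : ℝ))).tendsto _).comp hlim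
      refine le_of_tendsto' hlim' fun n => ?_
      simp only [Function.comp_apply]
      rw [← hline (ε n) (hε0 n)]
      exact le_iSup₂_of_le (α + ε n) (lt_add_of_pos_right α (hε0 n)) le_rfl
  rw [hsup, ← ENNReal.rpow_two, ← ENNReal.rpow_mul]
  norm_num

/-- A function given on vertical lines by the Fourier integrals of `e^{-ε|t|} G(t)` has boundary
values. -/
theorem ae_tendsto_boundaryValue [CompleteSpace E] {α : ℝ} {K : ℂ → E} {G : ℝ → E}
    (hG : MemLp G 2) (hK : ∀ ε, 0 < ε → ∀ τ, K (linePoint (α + ε) τ) = abelFourier ε G τ) :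
    (∀ᵐ τ : ℝ, Tendsto (fun σ => K (linePoint σ τ)) (𝓝[>] α) (𝓝 (boundaryValue α K τ))) ∧
      ∫⁻ τ : ℝ, ‖boundaryValue α K τ‖ₑ ^ 2
        = ENNReal.ofReal (2 * Real.pi) * ∫⁻ t, ‖G t‖ₑ ^ 2 := by
  obtain ⟨Φ, hΦ, hint⟩ := exists_ae_tendsto_abelFourier hG
  have hlim : ∀ᵐ τ : ℝ, Tendsto (fun σ => K (linePoint σ τ)) (𝓝[>] α) (𝓝 (Φ τ)) := by
    filter_upwards [hΦ] with τ hτ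
    refine (hτ.comp (tendsto_sub_const_nhdsGT α)).congr' ?_
    filter_upwards [self_mem_nhdsWithin] with σ hσ
    rw [Function.comp_apply, ← hK _ (sub_pos.mpr hσ), add_sub_cancel]
  have heq : ∀ᵐ τ : ℝ, boundaryValue α K τ = Φ τ := by
    filter_upwards [hlim] with τ hτ
    exact hτ.limUnder_eq
  refine ⟨?_, ?_⟩
  · filter_upwards [hlim, heq] with τ h1 h2
    rwa [h2]
  · rw [← hint]
    refine lintegral_congr_ae ?_
    filter_upwards [heq] with τ h
    rw [h]

/-- The Laplace transform of a weighted square integrable function is in the Hardy space. -/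
theorem memHardy_laplaceTransform [CompleteSpace E] {α : ℝ} {f : ℝ → E} (hf : MemWeightedL2 α f) :
    MemHardy α (laplaceTransform f) := by
  have hG := memLp_weighted hf
  have hK := fun ε (_ : 0 < ε) τ => laplaceTransform_linePoint α ε τ f
  have hfin : ∫⁻ t, ‖weighted α f t‖ₑ ^ 2 < ⊤ := by
    rw [lintegral_enorm_sq_eq]
    exact ENNReal.pow_lt_top hG.2
  obtain ⟨h1, h2⟩ := ae_tendsto_boundaryValue hG hK
  refine ⟨differentiableOn_laplaceTransform hf, ?_, h1, ?_⟩
  · have := hardyNorm_sq_eq hG hK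
    rw [← this] at hfin
    exact (ENNReal.pow_lt_top_iff.mp hfin).resolve_right two_ne_zero
  · rw [h2]
    exact ENNReal.mul_lt_top ENNReal.ofReal_lt_top hfin

/-- Applied to `Q = 1 - P_X`, this makes the projection error of the transform an Abel mean of the
projection error in time. -/
theorem map_abelFourier [CompleteSpace E] (Q : E →L[ℂ] E) {ε : ℝ} (hε : 0 < ε) {G : ℝ → E}
    (hG : MemLp G 2) (τ : ℝ) : Q (abelFourier ε G τ) = abelFourier ε (fun t => Q (G t)) τ := by
  rw [abelFourier, ← Q.integral_comp_comm (integrable_abelFourier hε τ hG)]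
  simp only [map_smul]
  rfl

end LaplaceHardy

open MeasureTheory Filter Topology
open scoped ENNReal ContDiff


/-! ### The real part of the boundary values -/

namespace IsComplexification

open Complex

variable {H E : Type} [NormedAddCommGroup H] [InnerProductSpace ℝ H] [FiniteDimensional ℝ H]
  [NormedAddCommGroup E] [InnerProductSpace ℂ E] {ι : H →ₗ[ℝ] E} (hι : IsComplexification ι)

omit [FiniteDimensional ℝ H] in
theorem weighted_map (ι : H →ₗ[ℝ] E) (α : ℝ) (u : ℝ → H) :
    weighted α (fun t => ι (u t)) = fun t => ι (weighted α u t) := by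
  funext t
  by_cases ht : t ∈ Set.Ioi (0 : ℝ)
  · simp only [weighted, Set.indicator_of_mem ht, map_smul]
  · simp only [weighted, Set.indicator_of_notMem ht, map_zero]

include hι in
theorem memWeightedL2_map {α : ℝ} {u : ℝ → H} (hu : MemWeightedL2 α u) :
    MemWeightedL2 α fun t => ι (u t) := by
  refine ⟨ι.continuous_of_finiteDimensional.comp_aestronglyMeasurable hu.1, ?_⟩
  simp only [← ofReal_norm, hι.norm_map]
  simpa only [ofReal_norm] using hu.2

variable [CompleteSpace E]

/-- The Fourier integrals of a real function, split into their real and imaginary parts. -/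
theorem abelFourier_map (ι : H →ₗ[ℝ] E) {ε : ℝ} (hε : 0 < ε) {g : ℝ → H} (hg : MemLp g 2) (τ : ℝ) :
    abelFourier ε (fun t => ι (g t)) τ
      = ι (∫ t, (Real.exp (-(ε * |t|)) * Real.cos (τ * t)) • g t)
        - I • ι (∫ t, (Real.exp (-(ε * |t|)) * Real.sin (τ * t)) • g t) := by
  have hexp : Integrable fun t : ℝ => Real.exp (-(ε * |t|)) • g t := by
    have h : MemLp ((fun t : ℝ => Real.exp (-(ε * |t|))) • g) 1 :=
      MemLp.smul (𝕜 := ℝ) hg (memLp_exp_neg_mul_abs hε)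
    exact memLp_one_iff_integrable.mp h
  have hbd : ∀ c : ℝ → ℝ, Measurable c → (∀ t, |c t| ≤ 1) →
      Integrable fun t : ℝ => (Real.exp (-(ε * |t|)) * c t) • g t := by
    intro c hc h1
    refine hexp.mono ((by fun_prop : Measurable fun t : ℝ =>
      Real.exp (-(ε * |t|)) * c t).aestronglyMeasurable.smul hg.1) (Eventually.of_forall fun t => ?_)
    rw [mul_comm, mul_smul, norm_smul]
    exact mul_le_of_le_one_left (norm_nonneg _) (h1 t)
  have hc := hbd (fun t => Real.cos (τ * t)) (by fun_prop) fun t => Real.abs_cos_le_one _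
  have hs := hbd (fun t => Real.sin (τ * t)) (by fun_prop) fun t => Real.abs_sin_le_one _
  set L : H →L[ℝ] E := ι.toContinuousLinearMap with hL
  have e1 := L.integral_comp_comm hc
  have e2 := L.integral_comp_comm hs
  have i1 := L.integrable_comp hc
  have i2 : Integrable fun t => I • L ((Real.exp (-(ε * |t|)) * Real.sin (τ * t)) • g t) :=
    (L.integrable_comp hs).smul I
  change _ = L _ - I • L _
  rw [← e1, ← e2, ← integral_smul, ← integral_sub i1 i2, abelFourier]
  refine integral_congr_ae (Eventually.of_forall fun t => ?_)
  have hr : ∀ (r : ℝ) (x : E), r • x = (r : ℂ) • x := fun r x => rfl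
  change cexp _ • L (g t) = _
  simp only [map_smul, hr, smul_smul, ← sub_smul]
  congr 1
  have : -((ε * |t| : ℝ) : ℂ) - I * τ * t = ((-(ε * |t|) : ℝ) : ℂ) + (-(τ * t : ℝ) : ℂ) * I := by
    push_cast
    ring
  rw [this, Complex.exp_add, Complex.exp_mul_I, Complex.cos_neg, Complex.sin_neg]
  push_cast
  ring

/-- The even part of a function. -/
def evenPart (G : ℝ → E) (t : ℝ) : E := (2⁻¹ : ℂ) • (G t + G (-t))

omit [CompleteSpace E] in
theorem memLp_evenPart {G : ℝ → E} (hG : MemLp G 2) : MemLp (evenPart G) 2 := by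
  have h : MemLp (fun t => G (-t)) 2 :=
    hG.comp_measurePreserving (Measure.measurePreserving_neg volume)
  exact (hG.add h).const_smul (2⁻¹ : ℂ)

omit [CompleteSpace E] in
theorem abelFourier_evenPart {ε : ℝ} (hε : 0 < ε) {G : ℝ → E} (hG : MemLp G 2) (τ : ℝ) :
    abelFourier ε (evenPart G) τ
      = (2⁻¹ : ℂ) • (abelFourier ε G τ + abelFourier ε G (-τ)) := by
  have h : MemLp (fun t => G (-t)) 2 :=
    hG.comp_measurePreserving (Measure.measurePreserving_neg volume)
  have hneg : abelFourier ε G (-τ) = abelFourier ε (fun t => G (-t)) τ := by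
    rw [abelFourier, abelFourier, ← integral_neg_eq_self]
    refine integral_congr_ae (Eventually.of_forall fun t => ?_)
    simp only [abs_neg]
    congr 2
    push_cast
    ring
  rw [hneg, abelFourier, abelFourier, abelFourier, ← integral_add (integrable_abelFourier hε τ hG)
    (integrable_abelFourier hε τ h), ← integral_smul]
  refine integral_congr_ae (Eventually.of_forall fun t => ?_)
  simp only [evenPart, smul_add, smul_comm (2⁻¹ : ℂ)]

omit [CompleteSpace E] in
/-- The even part of a function supported on `t > 0` has half of its square integral. -/
theorem lintegral_enorm_sq_evenPart {G : ℝ → E} (hG : AEStronglyMeasurable G volume)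
    (h0 : ∀ t ≤ 0, G t = 0) :
    ∫⁻ t, ‖evenPart G t‖ₑ ^ 2 = ENNReal.ofReal 2⁻¹ * ∫⁻ t, ‖G t‖ₑ ^ 2 := by
  -- At every `t` at least one of `G t` and `G (-t)` vanishes, so there is no cross term.
  have hpt : ∀ t, ‖evenPart G t‖ₑ ^ 2 = ENNReal.ofReal 4⁻¹ * (‖G t‖ₑ ^ 2 + ‖G (-t)‖ₑ ^ 2) := by
    intro t
    have hc : ‖(2⁻¹ : ℂ)‖ₑ ^ 2 = ENNReal.ofReal 4⁻¹ := by
      rw [enorm_sq_eq_ofReal]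
      norm_num
    rw [evenPart, enorm_smul, mul_pow, hc]
    congr 1
    rcases le_total t 0 with h | h
    · simp [h0 t h]
    · simp [h0 (-t) (by linarith)]
  have hneg : ∫⁻ t, ‖G (-t)‖ₑ ^ 2 = ∫⁻ t, ‖G t‖ₑ ^ 2 := by
    have := lintegral_comp_const_mul (fun t => ‖G t‖ₑ ^ 2) (neg_ne_zero.mpr one_ne_zero)
    simpa using this
  simp only [hpt]
  rw [lintegral_const_mul' _ _ ENNReal.ofReal_ne_top, lintegral_add_left' (hG.enorm.pow_const 2),
    hneg, ← two_mul, ← mul_assoc]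
  congr 1
  rw [← ENNReal.ofReal_ofNat, ← ENNReal.ofReal_mul (by norm_num)]
  norm_num

/-- Plancherel's identity for the real parts of the boundary values of a Laplace transform. -/
theorem lintegral_enorm_sq_re_boundaryValue [FiniteDimensional ℂ E] {ρ : E →ₗ[ℝ] H}
    (hρ : ∀ v w, ρ (ι v + I • ι w) = v) (hι : IsComplexification ι) {α : ℝ} {u : ℝ → H}
    (hu : MemWeightedL2 α u) (Q : E →L[ℂ] E) :
    ∫⁻ τ : ℝ, ‖Q (ι (ρ (boundaryValue α (laplaceTransform fun t => ι (u t)) τ)))‖ₑ ^ 2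
      = ENNReal.ofReal Real.pi * ∫⁻ t, ‖Q (ι (weighted α u t))‖ₑ ^ 2 := by
  have hf := hι.memWeightedL2_map hu
  have hg := memLp_weighted hu
  have hG := memLp_weighted hf
  have hwm := weighted_map ι α u
  set F := laplaceTransform fun t => ι (u t) with hF
  set G := weighted α fun t => ι (u t) with hGdef
  have hQG : MemLp (fun t => Q (evenPart G t)) 2 := Q.comp_memLp' (memLp_evenPart hG)
  -- For a real signal the real part at `τ` is the cosine integral, the mean of the transforms at
  -- `τ` and `-τ`, hence the Abel mean of the even part. The real part is not holomorphic, but only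
  -- its values on vertical lines matter here.
  have hK : ∀ ε, 0 < ε → ∀ τ, (fun s => Q (ι (ρ (F s)))) (linePoint (α + ε) τ)
      = abelFourier ε (fun t => Q (evenPart G t)) τ := by
    intro ε hε τ
    dsimp only
    rw [hF, laplaceTransform_linePoint, ← map_abelFourier Q hε (memLp_evenPart hG),
      abelFourier_evenPart hε hG, ← hGdef, hwm, abelFourier_map ι hε hg, abelFourier_map ι hε hg]
    congr 1
    have e : ∀ v w, ρ (ι v - I • ι w) = v := fun v w => by
      have := hρ v (-w)
      rwa [map_neg, smul_neg, ← sub_eq_add_neg] at this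
    rw [e]
    simp only [neg_mul, Real.cos_neg, Real.sin_neg, mul_neg, neg_smul, integral_neg, map_neg,
      smul_neg]
    module
  obtain ⟨h1, h2⟩ := ae_tendsto_boundaryValue (α := α) (K := fun s => Q (ι (ρ (F s)))) hQG hK
  have hcont : Continuous fun x : E => Q (ι (ρ x)) := by
    have : FiniteDimensional ℝ E := FiniteDimensional.complexToReal E
    exact Q.continuous.comp (ι.continuous_of_finiteDimensional.comp
      ρ.continuous_of_finiteDimensional)
  -- By continuity, taking the real part commutes with passing to the boundary.
  have heq : ∀ᵐ τ : ℝ, Q (ι (ρ (boundaryValue α F τ)))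
      = boundaryValue α (fun s => Q (ι (ρ (F s)))) τ := by
    filter_upwards [h1, (memHardy_laplaceTransform hf).2.2.1] with τ k1 k2
    exact tendsto_nhds_unique ((hcont.tendsto _).comp k2) k1
  have hev : ∀ t, Q (evenPart G t) = evenPart (fun t => Q (G t)) t := fun t => by
    simp [evenPart]
  rw [lintegral_congr_ae (heq.mono fun τ h => by rw [h]), h2]
  simp only [hev]
  rw [lintegral_enorm_sq_evenPart (Q.continuous.comp_aestronglyMeasurable hG.1) (fun t ht => by
    rw [hGdef, weighted, Set.indicator_of_notMem (by simpa using ht), map_zero]), ← mul_assoc,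
    ← ENNReal.ofReal_mul (by positivity), hwm]
  congr 2
  ring

/-- The projection error of a Laplace transform in the Hardy norm is a weighted `L²` projection
error. -/
theorem hardyNorm_laplaceTransform_sub_starProjection_sq [FiniteDimensional ℂ E]
    (hι : IsComplexification ι) {α : ℝ} {u : ℝ → H} (hu : MemWeightedL2 α u) (X : Submodule ℂ E) :
    hardyNorm α (fun s => laplaceTransform (fun t => ι (u t)) s -
        X.starProjection (laplaceTransform (fun t => ι (u t)) s)) ^ 2
      = ∫⁻ t, ‖ι (weighted α u t) - X.starProjection (ι (weighted α u t))‖ₑ ^ 2 := by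
  have hG := memLp_weighted (hι.memWeightedL2_map hu)
  set Q : E →L[ℂ] E := ContinuousLinearMap.id ℂ E - X.starProjection with hQ
  have hQx : ∀ x, Q x = x - X.starProjection x := fun x => rfl
  simp only [← hQx]
  rw [weighted_map] at hG
  refine hardyNorm_sq_eq (Q.comp_memLp' hG) fun ε hε τ => ?_
  rw [laplaceTransform_linePoint, weighted_map, map_abelFourier Q hε hG]

/-- Minimizers of the projection error of a Laplace transform in the Hardy norm, and of the
projection error of the real part of its boundary values. -/
theorem argmin_laplaceTransform [FiniteDimensional ℂ E] {ρ : E →ₗ[ℝ] H}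
    (hρ : ∀ v w, ρ (ι v + I • ι w) = v) (hι : IsComplexification ι) {α : ℝ} {u : ℝ → H}
    (hu : MemWeightedL2 α u) (R : ℕ) {J : Submodule ℂ E → ℝ≥0∞} {K : Submodule ℝ H → ℝ≥0∞}
    (hJ : J = fun X => hardyNorm α (fun s => laplaceTransform (fun t => ι (u t)) s -
        X.starProjection (laplaceTransform (fun t => ι (u t)) s)) ^ 2)
    (hK : K = fun V => ∫⁻ τ : ℝ,
        ‖ρ (boundaryValue α (laplaceTransform fun t => ι (u t)) τ) -
          V.starProjection (ρ (boundaryValue α (laplaceTransform fun t => ι (u t)) τ))‖ₑ ^ 2) :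
    (argmin J {X | Module.finrank ℂ X ≤ R}).Nonempty ∧
    (argmin K {V | Module.finrank ℝ V ≤ R}).Nonempty ∧
    (∀ V, complexSpan ι V ∈ argmin J {X | Module.finrank ℂ X ≤ R} ↔
      V ∈ argmin K {V | Module.finrank ℝ V ≤ R}) ∧
    (∀ W, argmin J {X | Module.finrank ℂ X ≤ R} = {W} ↔
      ∃ V, argmin K {V | Module.finrank ℝ V ≤ R} = {V} ∧ W = complexSpan ι V) := by
  obtain ⟨e, c, hc, hL⟩ := exists_orthonormalBasis_lintegral_enorm_sq (memLp_weighted hu)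
  have hJ' : ∀ X, J X = ∫⁻ t, ‖ι (weighted α u t) - X.starProjection (ι (weighted α u t))‖ₑ ^ 2 :=
    fun X => by
      simp only [hJ]
      rw [hι.hardyNorm_laplaceTransform_sub_starProjection_sq hu]
  -- The ratio `π` of the two costs is the `2π` of Plancherel times the half kept by the even part.
  refine hι.argmin_complexSpan e hc R (fun X => ?_) (k := ENNReal.ofReal Real.pi)
    (by rw [ne_eq, ENNReal.ofReal_eq_zero, not_le]; exact Real.pi_pos) ENNReal.ofReal_ne_top
    fun V => ?_
  · rw [hJ']
    -- The diagonalization is over `ℝ`, so `E` is given the real part of its inner product, which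
    -- has the same norm.
    exact @hL E _ InnerProductSpace.complexToReal (ι - X.starProjection.toLinearMap.restrictScalars ℝ ∘ₗ ι)
  · have h := lintegral_enorm_sq_re_boundaryValue hρ hι hu
      (ContinuousLinearMap.id ℂ E - (complexSpan ι V).starProjection)
    simp only [sub_apply, ContinuousLinearMap.id_apply,
      hι.starProjection_complexSpan, ← map_sub] at h
    rw [hJ', hK]
    simp only [hι.starProjection_complexSpan, ← map_sub]
    rw [← h]
    simp only [← ofReal_norm, hι.norm_map]

end IsComplexification

/-! ### The complexification of `V_h` -/

section

variable {d : ℕ} [NeZero d] {Ω : BoundedOpen d}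

theorem H10.inner_ofReal (v w : H10 Ω ℝ) :
    inner ℂ (H10.ofReal v) (H10.ofReal w) = ((inner ℝ v w : ℝ) : ℂ) := by
  rw [H10.inner_eq, H10.inner_eq, PiLp.inner_apply, PiLp.inner_apply, Complex.ofReal_sum]
  refine Finset.sum_congr rfl fun i _ => ?_
  rw [L2.inner_def, L2.inner_def, ← integral_complex_ofReal]
  refine integral_congr_ae ?_
  filter_upwards [Complex.ofRealCLM.coeFn_compLp (v.grad i),
    Complex.ofRealCLM.coeFn_compLp (w.grad i)] with x h1 h2
  have e1 : (H10.ofReal v).grad i = Complex.ofRealCLM.compLp (v.grad i) := rfl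
  have e2 : (H10.ofReal w).grad i = Complex.ofRealCLM.compLp (w.grad i) := rfl
  rw [e1, e2, h1, h2]
  simp [mul_comm]

variable (Vh : Submodule ℝ (H10 Ω ℝ))

theorem isComplexification_toComplex : IsComplexification (toComplex Vh) where
  inner_map v w := H10.inner_ofReal (v : H10 Ω ℝ) w
  exists_eq x := by
    obtain ⟨v, hv, w, hw, h⟩ := x.2
    exact ⟨⟨v, hv⟩, ⟨w, hw⟩, Subtype.ext h⟩

theorem complexToReal_add_I_smul (v w : Vh) :
    complexToReal Vh (toComplex Vh v + Complex.I • toComplex Vh w) = v := by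
  refine Subtype.ext ?_
  change H10.re (H10.ofReal (v : H10 Ω ℝ) + Complex.I • H10.ofReal (w : H10 Ω ℝ)) = v
  rw [map_add, H10.re_ofReal, H10.re_I_smul_ofReal, add_zero]

/-- The vectors `v + i w` already form a complex subspace, so the concrete complexification agrees
with the span used in the abstract argument. -/
theorem complexify_eq_complexSpan (V : Submodule ℝ Vh) :
    complexify Vh V = complexSpan (toComplex Vh) V := by
  refine le_antisymm (fun x hx => ?_) (Submodule.span_le.mpr ?_)
  · obtain ⟨_, ⟨v, hv, rfl⟩, _, ⟨w, hw, rfl⟩, h⟩ := hx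
    have hx' : x = toComplex Vh v + Complex.I • toComplex Vh w := Subtype.ext h
    rw [hx']
    exact Submodule.add_mem _ (Submodule.subset_span ⟨v, hv, rfl⟩)
      (Submodule.smul_mem _ _ (Submodule.subset_span ⟨w, hw, rfl⟩))
  · rintro _ ⟨v, hv, rfl⟩
    exact ⟨v, ⟨v, hv, rfl⟩, 0, Submodule.zero_mem _, by simp [toComplex]⟩

end

end

theorem mainTheorem5 {d : ℕ} [NeZero d] (Ω : BoundedOpen d)
    (Vh : Submodule ℝ (H10 Ω ℝ)) [FiniteDimensional ℝ Vh]
    (α : ℝ) (u : ℝ → Vh) (hu : MemWeightedL2 α u) (R : ℕ) :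
    MemHardy α (uHat Vh u) ∧
    (laplaceArgmin Vh α u R).Nonempty ∧
    (realArgmin Vh α u R).Nonempty ∧
    (∀ V : Submodule ℝ Vh,
      complexify Vh V ∈ laplaceArgmin Vh α u R ↔ V ∈ realArgmin Vh α u R) ∧
    (∀ W : Submodule ℂ (complexification Vh),
      laplaceArgmin Vh α u R = {W} ↔
        ∃ V : Submodule ℝ Vh, realArgmin Vh α u R = {V} ∧ W = complexify Vh V) := by
  have hι := isComplexification_toComplex Vh
  have h := hι.argmin_laplaceTransform (complexToReal_add_I_smul Vh) hu R rfl rfl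
  simp only [complexify_eq_complexSpan]
  exact ⟨memHardy_laplaceTransform (hι.memWeightedL2_map hu), h⟩
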